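/- Let $\mathcal A$ be a finite alphabet with the discrete topology and let $\tau$ be a substitution on $\mathcal A$, that is, a map from $\mathcal A$ to finite words over $\mathcal A$, extended to finite words and to right-infinite sequences by concatenation. Assume that - $\tau$ is primitive: for some $k\ge 1$, every letter occurs in $\tau^k(a)$ for every $a\in\mathcal A$; - for every $n\ge 1$, the map $a\mapsto\tau^n(a)$ is injective on $\mathcal A$; - $\tau$ is left proper: there is a letter $l$ such that every word $\tau(a)$, $a\in\mathcal A$, begins with $l$. Let $u=u_0u_1u_2\cdots\in\mathcal A^{\mathbb N}$ satisfy $\tau(u)=u$, and let $X_\tau=\overline{\{\sigma^n(u):n\ge 0\}}\subset\mathcal A^{\mathbb N}$, where $\sigma$ is the left shift. Assume further that - $\tau$ is aperiodic: $X_\tau$ contains no $\sigma$-periodic point; - $\tau$ is (unilaterally) recognizable: with $E=\{|\tau(u_0\cdots u_{p-1})|:p\ge 0\}$, there is $L$ such that $u_i\cdots u_{i+L-1}=u_j\cdots u_{j+L-1}$ and $i\in E$ imply $j\in E$; - $\tau$ is quasi-invertible: exactly one point of $X_\tau$ is a branch point, i.e. does not have exactly one preimage under $\sigma:X_\tau\to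 X_\tau$. Then there is a semi-proper stationary ordered Bratteli diagram $B$ such that $(X_B,V_B)$ is topologically conjugate to $(X_\tau,\sigma)$. Here a stationary ordered Bratteli diagram consists of one vertex $v_0$ at level $0$, the same finite vertex set $V$ at every level $n\ge1$, a finite nonempty set $E_1$ of edges from level $0$ to level $1$, the same finite set $E$ of edges from level $n-1$ to level $n$ for every $n\ge2$ (with the same source and range maps), every vertex being the source of some edge and every vertex other than $v_0$ the range of some edge, together with a linear order on the edges of $E_1$, and on those of $E$ (the same for all levels), with a given range. $X_B$ is the space of infinite paths $(x_n)_{n\ge1}$ from $v_0$, with the topology induced by the product of discrete topologies; a path is minimal (maximal) if all its edges are. $B$ is semi-proper if some positive power of the $V\times V$ incidence matrix counting edges of $E$ has only positive entries, and $B$ has exactly one minimal path $m$. The Vershik map $V_B:X_B\to X_B$ sends every maximal path to $m$, and sends a path $x$ whose first non-maximal edge is $x_k$ to the path $y$ in which $y_k$ is the successor of $x_k$, $y_n=x_n$ for $n>k$, and $y_n$ is minimal for $n<k$. -/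

import Mathlib

/-! ### Words, substitutions and their one-sided subshifts -/

section Substitutions

variable {A : Type*}

/-- The extension of a substitution `τ` to finite words, by concatenation. -/
def substWord (τ : A → List A) (w : List A) : List A := w.flatMap τ

/-- The word `τⁿ(a)`. -/
def substPow (τ : A → List A) (n : ℕ) (a : A) : List A := (substWord τ)^[n] [a]

/-- The prefix `x₀ x₁ ⋯ xₙ₋₁` of length `n` of a right-infinite sequence. -/
def seqPrefix (x : ℕ → A) (n : ℕ) : List A := (List.range n).map x

/-- `τ(x) = y` for right-infinite sequences: the infinite concatenation `τ(x₀) τ(x₁) ⋯` is an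
infinite sequence, and it is `y`. -/
def IsSubstImage (τ : A → List A) (x y : ℕ → A) : Prop :=
  (∀ n, substWord τ (seqPrefix x n) = seqPrefix y (substWord τ (seqPrefix x n)).length) ∧
    ∀ m, ∃ n, m ≤ (substWord τ (seqPrefix x n)).length

/-- `u` is a (right-infinite) fixed point of `τ`. -/
def IsSubstFixedPoint (τ : A → List A) (u : ℕ → A) : Prop := IsSubstImage τ u u

/-- `τ` is left proper: all the words `τ(a)` have the same first letter. -/
def IsLeftProper (τ : A → List A) : Prop := ∃ l : A, ∀ a, (τ a).head? = some l

/-- `τ` is primitive: for some `k > 0`, every letter occurs in every word `τᵏ(a)`. -/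
def IsPrimitiveSubst (τ : A → List A) : Prop :=
  ∃ k, 0 < k ∧ ∀ a b : A, b ∈ substPow τ k a

/-- All powers of `τ` are injective on letters. -/
def PowersInjective (τ : A → List A) : Prop :=
  ∀ n, Function.Injective (substPow τ n)

/-- The set of 1-cuttings of `u`: the lengths `|τ(u₀ ⋯ uₚ₋₁)|`, `p ≥ 0`. -/
def cuttings (τ : A → List A) (u : ℕ → A) : Set ℕ :=
  Set.range fun p => (substWord τ (seqPrefix u p)).length

/-- Unilateral recognizability of `τ` with respect to the fixed point `u`: for some `L`, whether
`i` is a 1-cutting of `u` depends only on the word of length `L` of `u` at position `i`. -/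
def IsRecognizable (τ : A → List A) (u : ℕ → A) : Prop :=
  ∃ L, ∀ i j, (∀ k < L, u (i + k) = u (j + k)) → i ∈ cuttings τ u → j ∈ cuttings τ u

/-- The left shift on right-infinite sequences. -/
def seqShift (x : ℕ → A) : ℕ → A := fun n => x (n + 1)

/-- The one-sided subshift generated by `u`, that is, the closure of its shift orbit. If `u` is a
fixed point of a primitive substitution `τ`, this is `X_τ`. -/
def generatedSubshift [TopologicalSpace A] (u : ℕ → A) : Set (ℕ → A) :=
  closure (Set.range fun n => seqShift^[n] u)

theorem continuous_seqShift [TopologicalSpace A] :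
    Continuous (seqShift : (ℕ → A) → (ℕ → A)) :=
  continuous_pi fun n => continuous_apply (n + 1)

theorem mapsTo_seqShift [TopologicalSpace A] (u : ℕ → A) :
    Set.MapsTo seqShift (generatedSubshift u) (generatedSubshift u) := by
  refine Set.MapsTo.closure ?_ continuous_seqShift
  rintro _ ⟨n, rfl⟩
  exact ⟨n + 1, Function.iterate_succ_apply' seqShift n u⟩

/-- The shift as a self-map of the subshift generated by `u`. -/
def subshiftMap [TopologicalSpace A] (u : ℕ → A) :
    generatedSubshift u → generatedSubshift u :=
  (mapsTo_seqShift u).restrict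

/-- The subshift generated by `u` is aperiodic: it contains no shift-periodic point. -/
def IsAperiodicSubshift [TopologicalSpace A] (u : ℕ → A) : Prop :=
  ∀ x ∈ generatedSubshift u, x ∉ Function.periodicPts seqShift

end Substitutions

/-- `y` is a branch point of `(Y, T)`: it is not `T`-invertible, that is, it does not have exactly
one preimage. (If `T` is onto, as the shift of a minimal subshift is, this means that `y` has at
least two preimages.) -/
def IsBranchPoint {Y : Type*} (T : Y → Y) (y : Y) : Prop := ¬ ∃! x, T x = y

/-- `(Y, T)` is quasi-invertible: it has exactly one branch point. -/
def IsQuasiInvertible {Y : Type*} (T : Y → Y) : Prop := ∃! y, IsBranchPoint T y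

/-! ### Stationary ordered Bratteli diagrams -/

/-- `lt` is a partial order on edges that compares edges with the same range only, and is linear on
every set `r⁻¹(v)`. -/
structure IsFibreOrder {E V : Type*} (r : E → V) (lt : E → E → Prop) : Prop where
  range_eq : ∀ e f, lt e f → r e = r f
  irrefl : ∀ e, ¬ lt e e
  trans : ∀ e f g, lt e f → lt f g → lt e g
  total : ∀ e f, r e = r f → lt e f ∨ e = f ∨ lt f e

/-- A stationary ordered Bratteli diagram. Level `0` consists of one vertex `v₀`, every level
`n ≥ 1` is a copy of `V`; `E₁` is the set of edges from `v₀` to level `1`, and a copy of `E` joins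
level `n - 1` to level `n` for every `n ≥ 2`. -/
structure StationaryBratteliDiagram where
  V : Type
  E₁ : Type
  E : Type
  [fintypeV : Fintype V]
  [decEqV : DecidableEq V]
  [fintypeE₁ : Fintype E₁]
  [fintypeE : Fintype E]
  r₁ : E₁ → V
  s : E → V
  r : E → V
  lt₁ : E₁ → E₁ → Prop
  lt : E → E → Prop
  nonempty_E₁ : Nonempty E₁
  r₁_surj : Function.Surjective r₁
  s_surj : Function.Surjective s
  r_surj : Function.Surjective r
  order₁ : IsFibreOrder r₁ lt₁
  order : IsFibreOrder r lt

namespace StationaryBratteliDiagram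

attribute [instance] fintypeV decEqV fintypeE₁ fintypeE

variable (B : StationaryBratteliDiagram)

/-- The incidence matrix: the entry at `(i, j)` is the number of edges in `E` from `j` to `i`. -/
noncomputable def incidence : Matrix B.V B.V ℕ :=
  fun i j => Nat.card {e : B.E // B.s e = j ∧ B.r e = i}

/-- `B` is simple: some power of its incidence matrix is positive. -/
def IsSimple : Prop := ∃ k, 0 < k ∧ ∀ i j, 0 < (B.incidence ^ k) i j

/-- `B.Edge n` is the set of edges from level `n` to level `n + 1`. -/
def Edge : ℕ → Type
  | 0 => B.E₁
  | _ + 1 => B.E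

/-- The set of edges between two consecutive levels carries the discrete topology. -/
instance instTopologicalSpaceEdge (n : ℕ) : TopologicalSpace (B.Edge n) := ⊥

/-- The range of an edge from level `n` to level `n + 1`. -/
def edgeRange : (n : ℕ) → B.Edge n → B.V
  | 0, e => B.r₁ e
  | _ + 1, e => B.r e

/-- The source of an edge from level `n + 1` to level `n + 2`. -/
def edgeSource (n : ℕ) (e : B.Edge (n + 1)) : B.V := B.s e

/-- The order on the edges from level `n` to level `n + 1`. -/
def edgeLT : (n : ℕ) → B.Edge n → B.Edge n → Prop
  | 0, e, f => B.lt₁ e f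
  | _ + 1, e, f => B.lt e f

/-- The edge `e` is maximal. -/
def IsMaxEdge (n : ℕ) (e : B.Edge n) : Prop := ∀ f, ¬ B.edgeLT n e f

/-- The edge `e` is minimal. -/
def IsMinEdge (n : ℕ) (e : B.Edge n) : Prop := ∀ f, ¬ B.edgeLT n f e

/-- The edge `f` is the (immediate) successor of the edge `e`. -/
def IsSuccEdge (n : ℕ) (e f : B.Edge n) : Prop :=
  B.edgeLT n e f ∧ ∀ g, ¬ (B.edgeLT n e g ∧ B.edgeLT n g f)

/-- The space `X_B` of infinite paths starting at `v₀`, with the topology induced from the product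
of the discrete edge sets. -/
def PathSpace : Type :=
  {x : (n : ℕ) → B.Edge n // ∀ n, B.edgeRange n (x n) = B.edgeSource n (x (n + 1))}

instance instTopologicalSpacePathSpace : TopologicalSpace B.PathSpace :=
  inferInstanceAs (TopologicalSpace
    {x : (n : ℕ) → B.Edge n // ∀ n, B.edgeRange n (x n) = B.edgeSource n (x (n + 1))})

variable {B}

/-- All edges of the path `x` are maximal. -/
def IsMaxPath (x : B.PathSpace) : Prop := ∀ n, B.IsMaxEdge n (x.1 n)

/-- All edges of the path `x` are minimal. -/
def IsMinPath (x : B.PathSpace) : Prop := ∀ n, B.IsMinEdge n (x.1 n)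

variable (B)

/-- `B` is semi-proper: it is simple and has a unique minimal path. -/
def IsSemiProper : Prop := B.IsSimple ∧ ∃! m : B.PathSpace, IsMinPath m

variable {B}

/-- `y` is the successor of the non-maximal path `x`: if `k` is the first position where `x` is not
maximal, then `y` has at position `k` the successor of that edge, agrees with `x` after position
`k`, and has minimal edges before position `k`. -/
def IsSuccPath (x y : B.PathSpace) : Prop :=
  ∃ k, (∀ j < k, B.IsMaxEdge j (x.1 j)) ∧ B.IsSuccEdge k (x.1 k) (y.1 k) ∧
    (∀ j < k, B.IsMinEdge j (y.1 j)) ∧ ∀ j, k < j → y.1 j = x.1 j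

/-- `y` is the Vershik image of `x`: the successor of `x` if `x` is not maximal, and a minimal path
if `x` is maximal. -/
def IsVershikImage (x y : B.PathSpace) : Prop :=
  (IsMaxPath x ∧ IsMinPath y) ∨ IsSuccPath x y

theorem edgeOrder (n : ℕ) : IsFibreOrder (B.edgeRange n) (B.edgeLT n) := by
  cases n with
  | zero => exact B.order₁
  | succ n => exact B.order

instance instFiniteEdge (n : ℕ) : Finite (B.Edge n) := by
  cases n with
  | zero => exact (inferInstance : Finite B.E₁)
  | succ n => exact (inferInstance : Finite B.E)

theorem edgeRange_surj (n : ℕ) : Function.Surjective (B.edgeRange n) := by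
  cases n with
  | zero => exact B.r₁_surj
  | succ n => exact B.r_surj

theorem exists_min_of_nonempty (n : ℕ) (S : Set (B.Edge n)) (hS : S.Nonempty) :
    ∃ e ∈ S, ∀ f ∈ S, ¬ B.edgeLT n f e := by
  have : IsTrans (B.Edge n) (B.edgeLT n) := ⟨(edgeOrder n).trans⟩
  have : Std.Irrefl (B.edgeLT n) := ⟨(edgeOrder n).irrefl⟩
  exact (Finite.wellFounded_of_trans_of_irrefl (B.edgeLT n)).has_min S hS

theorem exists_minEdge (n : ℕ) (v : B.V) : ∃ e, B.edgeRange n e = v ∧ B.IsMinEdge n e := by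
  obtain ⟨e, he, hmin⟩ := exists_min_of_nonempty n {e | B.edgeRange n e = v} (edgeRange_surj n v)
  refine ⟨e, he, fun f hf => hmin f ?_ hf⟩
  exact ((edgeOrder n).range_eq f e hf).trans he

theorem minEdge_unique {n : ℕ} {e f : B.Edge n} (h : B.edgeRange n e = B.edgeRange n f)
    (he : B.IsMinEdge n e) (hf : B.IsMinEdge n f) : e = f := by
  rcases (edgeOrder n).total e f h with h | h | h
  · exact absurd h (hf e)
  · exact h
  · exact absurd h (he f)

theorem exists_succEdge {n : ℕ} {e : B.Edge n} (he : ¬ B.IsMaxEdge n e) :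
    ∃ f, B.IsSuccEdge n e f := by
  obtain ⟨f, hf, hmin⟩ := exists_min_of_nonempty n {f | B.edgeLT n e f} (by
    simpa [IsMaxEdge, Set.Nonempty] using he)
  exact ⟨f, hf, fun g hg => hmin g hg.1 hg.2⟩

theorem succEdge_unique {n : ℕ} {e f g : B.Edge n} (hf : B.IsSuccEdge n e f)
    (hg : B.IsSuccEdge n e g) : f = g := by
  have hr : B.edgeRange n f = B.edgeRange n g :=
    ((edgeOrder n).range_eq _ _ hf.1).symm.trans ((edgeOrder n).range_eq _ _ hg.1)
  rcases (edgeOrder n).total f g hr with h | h | h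
  · exact absurd ⟨hf.1, h⟩ (hg.2 f)
  · exact h
  · exact absurd ⟨hg.1, h⟩ (hf.2 g)

theorem exists_path_minimal_before (k : ℕ) : ∀ (x : (n : ℕ) → B.Edge n) (f : B.Edge k),
    (∀ n, k < n → B.edgeRange n (x n) = B.edgeSource n (x (n + 1))) →
    B.edgeRange k f = B.edgeSource k (x (k + 1)) →
    ∃ y : B.PathSpace, (∀ j < k, B.IsMinEdge j (y.1 j)) ∧ y.1 k = f ∧
      ∀ j, k < j → y.1 j = x j := by
  induction k with
  | zero =>
    intro x f hx hf
    refine ⟨⟨Function.update x 0 f, ?_⟩, by simp, by simp, fun j hj => ?_⟩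
    · intro n
      rcases Nat.eq_zero_or_pos n with rfl | hn
      · simpa using hf
      · rw [Function.update_of_ne hn.ne', Function.update_of_ne (by omega)]
        exact hx n hn
    · exact Function.update_of_ne hj.ne' _ _
  | succ k ih =>
    intro x f hx hf
    obtain ⟨g, hg, hgmin⟩ := exists_minEdge (B := B) k (B.edgeSource k f)
    obtain ⟨y, hy1, hy2, hy3⟩ := ih (Function.update x (k + 1) f) g (by
      intro n hn
      rcases Nat.eq_or_lt_of_le (Nat.succ_le_of_lt hn) with h | h
      · subst h
        rw [Function.update_of_ne (by simp : k.succ + 1 ≠ k + 1)]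
        simpa using hf
      · rw [Function.update_of_ne (by omega), Function.update_of_ne (by omega)]
        exact hx n h) (by simpa using hg)
    refine ⟨y, fun j hj => ?_, by simpa using hy3 (k + 1) (by omega), fun j hj => ?_⟩
    · rcases Nat.eq_or_lt_of_le (Nat.le_of_lt_succ hj) with rfl | h
      · rw [hy2]; exact hgmin
      · exact hy1 j h
    · rw [hy3 j (by omega), Function.update_of_ne (by omega)]

theorem IsSuccPath.not_isMaxPath {x y : B.PathSpace} (h : IsSuccPath x y) : ¬ IsMaxPath x := by
  obtain ⟨k, -, hs, -⟩ := h
  exact fun hx => hx k _ hs.1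

theorem IsSuccPath.unique {x y z : B.PathSpace} (hy : IsSuccPath x y) (hz : IsSuccPath x z) :
    y = z := by
  obtain ⟨k, hk1, hk2, hk3, hk4⟩ := hy
  obtain ⟨l, hl1, hl2, hl3, hl4⟩ := hz
  obtain rfl : k = l := by
    rcases lt_trichotomy k l with h | h | h
    · exact absurd hk2.1 (hl1 k h _)
    · exact h
    · exact absurd hl2.1 (hk1 l h _)
  have hge : ∀ j, k ≤ j → y.1 j = z.1 j := by
    intro j hj
    rcases hj.eq_or_lt with rfl | h
    · exact succEdge_unique hk2 hl2
    · rw [hk4 j h, hl4 j h]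
  have hle : ∀ i ≤ k, y.1 (k - i) = z.1 (k - i) := by
    intro i
    induction i with
    | zero => exact fun _ => hge k le_rfl
    | succ i ih =>
      intro hi
      have h1 := ih (by omega)
      obtain ⟨m, hm⟩ : ∃ m, k - (i + 1) = m := ⟨_, rfl⟩
      have hm' : k - i = m + 1 := by omega
      rw [hm'] at h1
      rw [hm]
      refine minEdge_unique ?_ (hk3 m (by omega)) (hl3 m (by omega))
      rw [y.2 m, z.2 m, h1]
  apply Subtype.ext
  funext j
  rcases le_total k j with h | h
  · exact hge j h
  · have := hle (k - j) (by omega)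
    rwa [Nat.sub_sub_self h] at this

theorem exists_isSuccPath {x : B.PathSpace} (hx : ¬ IsMaxPath x) : ∃ y, IsSuccPath x y := by
  classical
  have hex : ∃ k, ¬ B.IsMaxEdge k (x.1 k) := by simpa [IsMaxPath] using hx
  obtain ⟨f, hf⟩ := exists_succEdge (Nat.find_spec hex)
  obtain ⟨y, hy1, hy2, hy3⟩ := exists_path_minimal_before (Nat.find hex) x.1 f
    (fun n _ => x.2 n) (by rw [← (edgeOrder _).range_eq _ _ hf.1]; exact x.2 _)
  exact ⟨y, Nat.find hex, fun j hj => not_not.mp (Nat.find_min hex hj),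
    by rw [hy2]; exact hf, hy1, hy3⟩

/-- In a semi-proper diagram every path has exactly one Vershik image. -/
theorem existsUnique_isVershikImage (hB : B.IsSemiProper) (x : B.PathSpace) :
    ∃! y, IsVershikImage x y := by
  by_cases hx : IsMaxPath x
  · obtain ⟨m, hm, hu⟩ := hB.2
    refine ⟨m, Or.inl ⟨hx, hm⟩, fun z hz => ?_⟩
    rcases hz with hz | hz
    · exact hu z hz.2
    · exact absurd hx hz.not_isMaxPath
  · obtain ⟨y, hy⟩ := exists_isSuccPath hx
    refine ⟨y, Or.inr hy, fun z hz => ?_⟩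
    rcases hz with hz | hz
    · exact absurd hz.1 hx
    · exact hz.unique hy

/-- The Vershik map `V_B : X_B → X_B` of a semi-proper diagram: a non-maximal path is sent to its
successor, and all maximal paths are sent to the unique minimal path. -/
noncomputable def vershikMap (hB : B.IsSemiProper) : B.PathSpace → B.PathSpace :=
  fun x => (existsUnique_isVershikImage hB x).choose

theorem isVershikImage_vershikMap (hB : B.IsSemiProper) (x : B.PathSpace) :
    IsVershikImage x (vershikMap hB x) :=
  (existsUnique_isVershikImage hB x).choose_spec.1

end StationaryBratteliDiagram

/-- The systems `(X, S)` and `(Y, T)` are topologically conjugate. -/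
def TopologicallyConjugate {X Y : Type*} [TopologicalSpace X] [TopologicalSpace Y]
    (S : X → X) (T : Y → Y) : Prop :=
  ∃ Φ : X ≃ₜ Y, ∀ x, Φ (S x) = T (Φ x)

/-! Write X for the subshift and σ for the shift. By minimality σ is onto, so the branch point w has
at least two preimages. Apply τ to two of them, `a w` and `b w`: the images merge at τ(w). Read
backwards from there they coincide until w is met, because σ is injective away from w. If w were not
met, the shorter of τ(a), τ(b) would be exhausted, and recognizability together with injectivity of
τ would identify the two preimages. Hence w = s τ(w), where s is a suffix of τ(a) for every letter a
that can precede w (`exists_suffix_length`).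

The alphabet being finite, the same s works for every letter preceding a point of a long enough
cylinder Z around w (`exists_window`). So θ(x) = s τ(x) maps Z into itself and contracts it to w. If
R is the return map of σ to Z, then θ conjugates R to the return map of R to θ(Z) (`tower_return`).
Thus X is a tower over Z, and Z is a tower over a copy of itself. Although σ is not invertible,
heights and base points are unique, because injectivity fails only over w, which lies in both bases
(`exists_tower`).

Label a point of Z by its return word. The label determines the heights of both towers and the
labels of the floors of the second (`returnWord_iterate_eq`). Iterating the decomposition therefore
codes X by the paths of one stationary diagram (`AdicData`), on which σ acts as addition of one with
carry. Compactness makes the coding onto and a homeomorphism, the letters in the return words make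
it injective, contraction to w makes the minimal path unique, and minimality makes the incidence
matrix primitive. -/

set_option linter.unusedSectionVars false

/-! ### Adic coding of a self-similar system -/

/-- The order on pairs `(v, i)` that compares the second coordinates of pairs with the same first
coordinate. -/
def pairLT {V : Type} (h : V → ℕ) (e f : {p : V × ℕ // p.2 < h p.1}) : Prop :=
  e.1.1 = f.1.1 ∧ e.1.2 < f.1.2

theorem isFibreOrder_pairLT {V : Type} (h : V → ℕ) :
    IsFibreOrder (fun e : {p : V × ℕ // p.2 < h p.1} => e.1.1) (pairLT h) where
  range_eq _ _ hef := hef.1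
  irrefl _ he := lt_irrefl _ he.2
  trans _ _ _ h₁ h₂ := ⟨h₁.1.trans h₂.1, h₁.2.trans h₂.2⟩
  total e f hef := by
    rcases lt_trichotomy e.1.2 f.1.2 with h | h | h
    · exact Or.inl ⟨hef, h⟩
    · exact Or.inr (Or.inl (Subtype.ext (Prod.ext hef h)))
    · exact Or.inr (Or.inr ⟨hef.symm, h⟩)

theorem pairLT_min_iff {V : Type} (e : V × ℕ) (f : V → ℕ) (he : e.2 < f e.1) :
    (∀ g, ¬ pairLT f g ⟨e, he⟩) ↔ e.2 = 0 := by
  constructor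
  · intro h
    by_contra h0
    exact h ⟨(e.1, 0), by simp only; omega⟩ ⟨rfl, Nat.pos_of_ne_zero h0⟩
  · rintro h g ⟨-, h2⟩
    simp only [h] at h2
    omega

theorem pairLT_max_iff {V : Type} (e : V × ℕ) (f : V → ℕ) (he : e.2 < f e.1) :
    (∀ g, ¬ pairLT f ⟨e, he⟩ g) ↔ e.2 + 1 = f e.1 := by
  constructor
  · intro h
    by_contra h0
    exact h ⟨(e.1, e.2 + 1), by simp only; omega⟩ ⟨rfl, Nat.lt_succ_self _⟩
  · rintro h ⟨g, hg⟩ ⟨h1, h2⟩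
    simp only at h1 h2
    rw [← h1] at hg
    omega

theorem pairLT_succ {V : Type} (f : V → ℕ) (e g : {p : V × ℕ // p.2 < f p.1}) (h1 : g.1.1 = e.1.1)
    (h2 : g.1.2 = e.1.2 + 1) : pairLT f e g ∧ ∀ k, ¬ (pairLT f e k ∧ pairLT f k g) := by
  refine ⟨⟨h1.symm, by omega⟩, ?_⟩
  rintro k ⟨⟨-, h3⟩, ⟨-, h4⟩⟩
  omega

theorem finite_pairs {V : Type} [Finite V] (h : V → ℕ) : Finite {p : V × ℕ // p.2 < h p.1} :=
  Finite.of_injective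
    (fun p : {p : V × ℕ // p.2 < h p.1} => (⟨p.1.1, ⟨p.1.2, p.2⟩⟩ : Σ v, Fin (h v))) (by
      rintro ⟨⟨v, i⟩, hi⟩ ⟨⟨v', i'⟩, hi'⟩ heq
      obtain ⟨rfl, h2⟩ := Sigma.mk.inj_iff.1 heq
      have := congrArg Fin.val (eq_of_heq h2)
      simp only at this
      subst this
      rfl)

/-- A path through the given vertices contributes one positive summand to each matrix product. -/
theorem incidence_pow_pos_of_edges (B : StationaryBratteliDiagram) (a : ℕ → B.V)
    (h : ∀ i, ∃ e, B.s e = a i ∧ B.r e = a (i + 1)) (n : ℕ) :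
    0 < (B.incidence ^ n) (a n) (a 0) := by
  induction n with
  | zero => simp
  | succ n ih =>
    rw [pow_succ', Matrix.mul_apply]
    refine lt_of_lt_of_le (Nat.mul_pos ?_ ih) (Finset.single_le_sum
      (f := fun v => B.incidence (a (n + 1)) v * (B.incidence ^ n) v (a 0))
      (fun _ _ => Nat.zero_le _) (Finset.mem_univ (a n)))
    obtain ⟨e, he⟩ := h n
    have : Nonempty {e : B.E // B.s e = a n ∧ B.r e = a (n + 1)} := ⟨⟨e, he⟩⟩
    exact Nat.card_pos

/-- The data of a system `(X, T)` that is a tower over a system `(Z, S)`, which is in turn a tower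
over itself: `x` is the point at height `ht x` over `base x`, and `z` is the point at height
`idx z` over `tail z`. The heights of the towers, and the label of each floor, depend on the label
`c` of the base point only. -/
structure AdicData {X Z : Type*} [TopologicalSpace X] [TopologicalSpace Z]
    (T : X → X) (S : Z → Z) (V : Type) where
  c : Z → V
  h : V → ℕ
  len : V → ℕ
  src : V → ℕ → V
  base : X → Z
  ht : X → ℕ
  tail : Z → Z
  idx : Z → ℕ
  c_surj : Function.Surjective c
  h_pos : ∀ v, 0 < h v
  len_pos : ∀ v, 0 < len v
  ht_lt : ∀ x, ht x < h (c (base x))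
  idx_lt : ∀ z, idx z < len (c (tail z))
  exists_base : ∀ z k, k < h (c z) → ∃ x, base x = z ∧ ht x = k
  exists_tail : ∀ z k, k < len (c z) → ∃ y, tail y = z ∧ idx y = k
  base_succ : ∀ x, ht x + 1 < h (c (base x)) → base (T x) = base x ∧ ht (T x) = ht x + 1
  base_top : ∀ x, ht x + 1 = h (c (base x)) → base (T x) = S (base x) ∧ ht (T x) = 0
  tail_succ : ∀ z, idx z + 1 < len (c (tail z)) → tail (S z) = tail z ∧ idx (S z) = idx z + 1
  tail_top : ∀ z, idx z + 1 = len (c (tail z)) → tail (S z) = S (tail z) ∧ idx (S z) = 0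
  c_eq : ∀ z, c z = src (c (tail z)) (idx z)
  isLocallyConstant_c : IsLocallyConstant c
  continuous_base : Continuous base
  continuous_tail : Continuous tail
  continuous_ht : Continuous ht
  continuous_idx : Continuous idx

namespace AdicData

open StationaryBratteliDiagram

variable {X Z : Type*} [TopologicalSpace X] [TopologicalSpace Z] {T : X → X} {S : Z → Z}
  {V : Type} (d : AdicData T S V)

/-- The diagram of a self-similar system. -/
noncomputable def diagram [Fintype V] [DecidableEq V] [Nonempty V] :
    StationaryBratteliDiagram where
  V := V
  E₁ := {p : V × ℕ // p.2 < d.h p.1}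
  E := {p : V × ℕ // p.2 < d.len p.1}
  fintypeE₁ := have := finite_pairs d.h; Fintype.ofFinite _
  fintypeE := have := finite_pairs d.len; Fintype.ofFinite _
  r₁ e := e.1.1
  s e := d.src e.1.1 e.1.2
  r e := e.1.1
  lt₁ := pairLT d.h
  lt := pairLT d.len
  nonempty_E₁ := ⟨⟨(Classical.arbitrary V, 0), d.h_pos _⟩⟩
  r₁_surj v := ⟨⟨(v, 0), d.h_pos v⟩, rfl⟩
  s_surj v := by
    obtain ⟨z, rfl⟩ := d.c_surj v
    exact ⟨⟨(d.c (d.tail z), d.idx z), d.idx_lt z⟩, (d.c_eq z).symm⟩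
  r_surj v := ⟨⟨(v, 0), d.len_pos v⟩, rfl⟩
  order₁ := isFibreOrder_pairLT d.h
  order := isFibreOrder_pairLT d.len

/-- If the points over `a` include one with a given label, so do the points over any `b` with the
same label as `a`. -/
theorem exists_lift (n : ℕ) : ∀ (y a b : Z), d.tail^[n] y = a → d.c a = d.c b →
    ∃ y', d.tail^[n] y' = b ∧ d.c y' = d.c y := by
  induction n with
  | zero => rintro y a b rfl h; exact ⟨b, rfl, h.symm⟩
  | succ n ih =>
    intro y a b hy hab
    obtain ⟨y₁, h₁, h₂⟩ := ih (d.tail y) a b hy hab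
    obtain ⟨y', h₃, h₄⟩ := d.exists_tail y₁ (d.idx y) (h₂ ▸ d.idx_lt y)
    refine ⟨y', by rw [Function.iterate_succ_apply, h₃, h₁], ?_⟩
    rw [d.c_eq y', d.c_eq y, h₃, h₄, h₂]

section

variable [Fintype V] [DecidableEq V] [Nonempty V]

/-- The edges of the path of a point. -/
def codeEdge (x : X) : (n : ℕ) → d.diagram.Edge n
  | 0 => (⟨(d.c (d.base x), d.ht x), d.ht_lt x⟩ : {p : V × ℕ // p.2 < d.h p.1})
  | n + 1 => (⟨(d.c (d.tail (d.tail^[n] (d.base x))), d.idx (d.tail^[n] (d.base x))),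
      d.idx_lt _⟩ : {p : V × ℕ // p.2 < d.len p.1})

theorem edgeRange_codeEdge (x : X) (n : ℕ) :
    d.diagram.edgeRange n (d.codeEdge x n) = d.c (d.tail^[n] (d.base x)) := by
  cases n with
  | zero => rfl
  | succ n => rw [Function.iterate_succ_apply']; rfl

/-- The path of a point. -/
def code (x : X) : d.diagram.PathSpace :=
  ⟨d.codeEdge x, fun n => by
    rw [edgeRange_codeEdge]
    exact d.c_eq _⟩

theorem isMaxEdge_code_zero (x : X) :
    d.diagram.IsMaxEdge 0 (d.codeEdge x 0) ↔ d.ht x + 1 = d.h (d.c (d.base x)) :=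
  pairLT_max_iff (_, _) d.h _

theorem isMaxEdge_code_succ (x : X) (n : ℕ) :
    d.diagram.IsMaxEdge (n + 1) (d.codeEdge x (n + 1)) ↔
      d.idx (d.tail^[n] (d.base x)) + 1 = d.len (d.c (d.tail (d.tail^[n] (d.base x)))) :=
  pairLT_max_iff (_, _) d.len _

theorem isMinEdge_code_zero (x : X) :
    d.diagram.IsMinEdge 0 (d.codeEdge x 0) ↔ d.ht x = 0 :=
  pairLT_min_iff (_, _) d.h _

theorem isMinEdge_code_succ (x : X) (n : ℕ) :
    d.diagram.IsMinEdge (n + 1) (d.codeEdge x (n + 1)) ↔ d.idx (d.tail^[n] (d.base x)) = 0 :=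
  pairLT_min_iff (_, _) d.len _

/-- The carry of the odometer: a point on the top floor moves to the bottom floor, and the move is
passed on to its base point, one level up. -/
theorem tail_iterate_of_max (x : X) (n : ℕ)
    (hmax : ∀ j ≤ n, d.diagram.IsMaxEdge j (d.codeEdge x j)) :
    d.tail^[n] (d.base (T x)) = S (d.tail^[n] (d.base x)) ∧
      d.diagram.IsMinEdge n (d.codeEdge (T x) n) := by
  induction n with
  | zero =>
    obtain ⟨h1, h2⟩ := d.base_top x ((d.isMaxEdge_code_zero x).1 (hmax 0 le_rfl))
    exact ⟨h1, (d.isMinEdge_code_zero _).2 h2⟩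
  | succ n ih =>
    obtain ⟨h1, -⟩ := ih fun j hj => hmax j (by omega)
    obtain ⟨h3, h4⟩ := d.tail_top _ ((d.isMaxEdge_code_succ x n).1 (hmax _ le_rfl))
    refine ⟨?_, (d.isMinEdge_code_succ _ _).2 (by rw [h1, h4])⟩
    rw [Function.iterate_succ_apply', h1, h3, Function.iterate_succ_apply']

theorem codeEdge_eq_of_tail_eq {x y : X} {k : ℕ}
    (h : d.tail^[k] (d.base x) = d.tail^[k] (d.base y)) (j : ℕ) (hj : k < j) :
    d.codeEdge x j = d.codeEdge y j := by
  obtain ⟨i, rfl⟩ : ∃ i, j = (i + k) + 1 := ⟨j - k - 1, by omega⟩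
  have : d.tail^[i + k] (d.base x) = d.tail^[i + k] (d.base y) := by
    rw [Function.iterate_add_apply, h, ← Function.iterate_add_apply]
  exact Subtype.ext (Prod.ext (congrArg (fun z => d.c (d.tail z)) this) (congrArg d.idx this))

theorem isVershikImage_code (x : X) : IsVershikImage (d.code x) (d.code (T x)) := by
  classical
  -- On a maximal path the carry never stops, so every edge of the image is minimal. Otherwise it
  -- stops at the first non-maximal edge k, and nothing changes above.
  by_cases hx : IsMaxPath (d.code x)
  · exact Or.inl ⟨hx, fun n => (d.tail_iterate_of_max x n fun j _ => hx j).2⟩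
  right
  have hex : ∃ k, ¬ d.diagram.IsMaxEdge k (d.codeEdge x k) := by
    simpa [IsMaxPath, code] using hx
  obtain ⟨k, hk, hlt⟩ : ∃ k, ¬ d.diagram.IsMaxEdge k (d.codeEdge x k) ∧
      ∀ j < k, d.diagram.IsMaxEdge j (d.codeEdge x j) :=
    ⟨Nat.find hex, Nat.find_spec hex, fun j hj => not_not.1 (Nat.find_min hex hj)⟩
  refine ⟨k, hlt, ?_⟩
  rcases k with _ | n
  · rw [isMaxEdge_code_zero] at hk
    have := d.ht_lt x
    obtain ⟨h1, h2⟩ := d.base_succ x (by omega)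
    refine ⟨pairLT_succ d.h _ _ (congrArg d.c h1) h2, by simp, fun j hj => ?_⟩
    exact d.codeEdge_eq_of_tail_eq (k := 0) h1 j hj
  · rw [isMaxEdge_code_succ] at hk
    have h0 := d.idx_lt (d.tail^[n] (d.base x))
    obtain ⟨h1, -⟩ := d.tail_iterate_of_max x n fun j hj => hlt j (by omega)
    obtain ⟨h2, h3⟩ := d.tail_succ (d.tail^[n] (d.base x)) (by omega)
    refine ⟨pairLT_succ d.len _ _ ?_ ?_, fun j hj => ?_, fun j hj => ?_⟩
    · change d.c (d.tail (d.tail^[n] (d.base (T x)))) = d.c (d.tail (d.tail^[n] (d.base x)))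
      rw [h1, h2]
    · change d.idx (d.tail^[n] (d.base (T x))) = _
      rw [h1, h3]
      rfl
    · exact (d.tail_iterate_of_max x j fun i hi => hlt i (by omega)).2
    · refine d.codeEdge_eq_of_tail_eq (k := n + 1) ?_ j hj
      rw [Function.iterate_succ_apply', Function.iterate_succ_apply', h1, h2]

theorem continuous_code : Continuous d.code := by
  refine Continuous.subtype_mk (continuous_pi fun n => ?_) _
  let _ : TopologicalSpace V := ⊥
  have : DiscreteTopology V := ⟨rfl⟩
  have hc : Continuous d.c := d.isLocallyConstant_c.continuous
  cases n with
  | zero =>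
    have h1 : Continuous fun x => (⟨(d.c (d.base x), d.ht x), d.ht_lt x⟩ :
        {p : V × ℕ // p.2 < d.h p.1}) :=
      ((hc.comp d.continuous_base).prodMk d.continuous_ht).subtype_mk _
    -- The edge set carries `⊥`, whereas `h1` uses the subtype topology; local constancy does not
    -- refer to a topology on the target and passes from one to the other.
    have h2 := (IsLocallyConstant.iff_continuous _).2 h1
    exact @IsLocallyConstant.continuous _ _ _ ⊥ _ h2
  | succ n =>
    have h0 : Continuous fun x => d.tail^[n] (d.base x) :=
      (d.continuous_tail.iterate n).comp d.continuous_base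
    have h1 : Continuous fun x => (⟨(d.c (d.tail (d.tail^[n] (d.base x))),
        d.idx (d.tail^[n] (d.base x))), d.idx_lt _⟩ : {p : V × ℕ // p.2 < d.len p.1}) :=
      ((hc.comp (d.continuous_tail.comp h0)).prodMk (d.continuous_idx.comp h0)).subtype_mk _
    have h2 := (IsLocallyConstant.iff_continuous _).2 h1
    exact @IsLocallyConstant.continuous _ _ _ ⊥ _ h2

/-- The path is realized from the top down: start at a point z with the label of the last vertex and
descend to the floor prescribed by each edge. The path condition says that the floor reached has the
label needed next. -/
theorem exists_code_eq_upTo (p : d.diagram.PathSpace) (n : ℕ) :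
    ∀ z, d.c z = d.diagram.edgeRange n (p.1 n) →
      ∃ x, d.tail^[n] (d.base x) = z ∧ ∀ j ≤ n, d.codeEdge x j = p.1 j := by
  induction n with
  | zero =>
    intro z hz
    generalize hp : p.1 0 = e at hz
    obtain ⟨⟨v, k⟩, hk⟩ := (e : {p : V × ℕ // p.2 < d.h p.1})
    change d.c z = v at hz
    subst hz
    obtain ⟨x, rfl, rfl⟩ := d.exists_base z k hk
    refine ⟨x, rfl, fun j hj => ?_⟩
    obtain rfl : j = 0 := by omega
    rw [hp]
    rfl
  | succ n ih =>
    intro z hz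
    have hps := p.2 n
    generalize hp : p.1 (n + 1) = e at hz hps
    obtain ⟨⟨v, k⟩, hk⟩ := (e : {p : V × ℕ // p.2 < d.len p.1})
    change d.c z = v at hz
    subst hz
    obtain ⟨y, rfl, rfl⟩ := d.exists_tail z k hk
    obtain ⟨x, rfl, hx⟩ := ih y ((d.c_eq y).trans hps.symm)
    refine ⟨x, Function.iterate_succ_apply' _ _ _, fun j hj => ?_⟩
    rcases Nat.lt_or_ge j (n + 1) with h | h
    · exact hx j (by omega)
    · obtain rfl : j = n + 1 := by omega
      rw [hp]
      rfl

/-- The points whose codes follow p up to level n form a decreasing sequence of nonempty closed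
sets. -/
theorem surjective_code [CompactSpace X] : Function.Surjective d.code := by
  intro p
  have hcont := d.continuous_code
  have hev : ∀ n, Continuous fun x => d.codeEdge x n := fun n =>
    (continuous_apply n).comp (continuous_subtype_val.comp hcont)
  have hcl : ∀ n, IsClosed {x | ∀ j ≤ n, d.codeEdge x j = p.1 j} := by
    intro n
    have : {x | ∀ j ≤ n, d.codeEdge x j = p.1 j} =
        ⋂ j, ⋂ (_ : j ≤ n), (fun x => d.codeEdge x j) ⁻¹' {p.1 j} := by ext; simp
    rw [this]
    refine isClosed_iInter fun j => isClosed_iInter fun _ => IsClosed.preimage (hev j) ?_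
    have : DiscreteTopology (d.diagram.Edge j) := ⟨rfl⟩
    exact isClosed_discrete _
  obtain ⟨x, hx⟩ := IsCompact.nonempty_iInter_of_sequence_nonempty_isCompact_isClosed
    (fun n => {x | ∀ j ≤ n, d.codeEdge x j = p.1 j})
    (fun n x hx j hj => hx j (by omega))
    (fun n => by
      obtain ⟨z, hz⟩ := d.c_surj (d.diagram.edgeRange n (p.1 n))
      obtain ⟨x, -, hx⟩ := d.exists_code_eq_upTo p n z hz
      exact ⟨x, hx⟩) (hcl 0).isCompact hcl
  refine ⟨x, Subtype.ext (funext fun n => ?_)⟩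
  exact Set.mem_iInter.1 hx n n le_rfl

/-! ### Simplicity and minimal paths of the diagram -/

theorem incidence_pow_pos (n : ℕ) (z : Z) :
    0 < (d.diagram.incidence ^ n) (d.c (d.tail^[n] z)) (d.c z) := by
  refine incidence_pow_pos_of_edges d.diagram (fun i => d.c (d.tail^[i] z)) (fun i => ?_) n
  refine ⟨(⟨(d.c (d.tail (d.tail^[i] z)), d.idx (d.tail^[i] z)), d.idx_lt _⟩ :
    {p : V × ℕ // p.2 < d.len p.1}), (d.c_eq _).symm, ?_⟩
  rw [Function.iterate_succ_apply']
  rfl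

/-- The label of the first floor of the tower labelled `v`. -/
def firstLabel (v : V) : V := d.src v 0

theorem exists_minPath (v₀ : V) (h : d.firstLabel v₀ = v₀) :
    ∃ m : d.diagram.PathSpace, IsMinPath m := by
  refine ⟨⟨fun n => match n with
    | 0 => (⟨(v₀, 0), d.h_pos _⟩ : {p : V × ℕ // p.2 < d.h p.1})
    | n + 1 => (⟨(v₀, 0), d.len_pos _⟩ : {p : V × ℕ // p.2 < d.len p.1}), ?_⟩, ?_⟩
  · rintro (_ | n)
    · exact h.symm
    · exact h.symm
  · rintro (_ | n)
    · exact (pairLT_min_iff (v₀, 0) d.h (d.h_pos _)).2 rfl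
    · exact (pairLT_min_iff (v₀, 0) d.len (d.len_pos _)).2 rfl

theorem edgeRange_of_isMinPath {m : d.diagram.PathSpace} (hm : IsMinPath m) (n : ℕ) :
    d.diagram.edgeRange n (m.1 n) = d.firstLabel (d.diagram.edgeRange (n + 1) (m.1 (n + 1))) := by
  rw [m.2 n]
  have := hm (n + 1)
  generalize m.1 (n + 1) = e at this
  obtain ⟨⟨v, k⟩, hk⟩ := (e : {p : V × ℕ // p.2 < d.len p.1})
  obtain rfl : k = 0 := (pairLT_min_iff (v, k) d.len hk).1 this
  rfl

/-- Along a minimal path each vertex is the first label of the next one, so looking N levels ahead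
shows that every vertex is `v₀`; the minimal edge into `v₀` is unique. -/
theorem minPath_unique (N : ℕ) (v₀ : V) (hN : ∀ v, d.firstLabel^[N] v = v₀)
    {m m' : d.diagram.PathSpace} (hm : IsMinPath m) (hm' : IsMinPath m') : m = m' := by
  have key : ∀ {m : d.diagram.PathSpace}, IsMinPath m → ∀ n,
      d.diagram.edgeRange n (m.1 n) = v₀ := by
    intro m hm n
    have : ∀ k, d.diagram.edgeRange n (m.1 n) =
        d.firstLabel^[k] (d.diagram.edgeRange (n + k) (m.1 (n + k))) := by
      intro k
      induction k with
      | zero => rfl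
      | succ k ih =>
        exact ih.trans (congrArg d.firstLabel^[k] (edgeRange_of_isMinPath d hm (n + k)))
    rw [this N]
    exact hN _
  refine Subtype.ext (funext fun n => ?_)
  exact minEdge_unique ((key hm n).trans (key hm' n).symm) (hm n) (hm' n)

/-- A self-similar system whose labelling is primitive, with an eventually constant first label, and
whose points are separated by the first edges along orbits, is conjugate to a Vershik map. -/
theorem exists_conjugate [CompactSpace X] (N : ℕ) (v₀ : V)
    (hfix : d.firstLabel v₀ = v₀) (hN : ∀ v, d.firstLabel^[N] v = v₀)
    (K : ℕ) (hK : 0 < K) (hprim : ∀ v v', ∃ z, d.c z = v ∧ d.c (d.tail^[K] z) = v')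
    (hsep : ∀ x x', (∀ n, d.c (d.base (T^[n] x)) = d.c (d.base (T^[n] x')) ∧
      d.ht (T^[n] x) = d.ht (T^[n] x')) → x = x') :
    ∃ (B : StationaryBratteliDiagram) (hB : B.IsSemiProper),
      TopologicallyConjugate (vershikMap hB) T := by
  have hB : d.diagram.IsSemiProper := by
    refine ⟨⟨K, hK, fun i j => ?_⟩, ?_⟩
    · obtain ⟨z, rfl, rfl⟩ := hprim j i
      exact d.incidence_pow_pos K z
    · obtain ⟨m, hm⟩ := d.exists_minPath v₀ hfix
      exact ⟨m, hm, fun m' hm' => d.minPath_unique N v₀ hN hm' hm⟩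
  have hcode : ∀ x, vershikMap hB (d.code x) = d.code (T x) := fun x =>
    (existsUnique_isVershikImage hB (d.code x)).unique (isVershikImage_vershikMap hB _)
      (d.isVershikImage_code x)
  have hinj : Function.Injective d.code := by
    intro x x' hxx
    refine hsep x x' fun n => ?_
    -- Equal codes stay equal along the orbits, since the code intertwines T with the Vershik map.
    have : d.code (T^[n] x) = d.code (T^[n] x') := by
      induction n with
      | zero => exact hxx
      | succ n ih => rw [Function.iterate_succ_apply', Function.iterate_succ_apply', ← hcode, ih,
          hcode]
    have h0 : d.codeEdge (T^[n] x) 0 = d.codeEdge (T^[n] x') 0 :=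
      congrFun (congrArg Subtype.val this) 0
    have h1 := congrArg Subtype.val (show (⟨(_, _), d.ht_lt (T^[n] x)⟩ :
      {p : V × ℕ // p.2 < d.h p.1}) = ⟨(_, _), d.ht_lt (T^[n] x')⟩ from h0)
    exact Prod.ext_iff.1 h1
  have hT2 : T2Space d.diagram.PathSpace := by
    have : ∀ n, DiscreteTopology (d.diagram.Edge n) := fun n => ⟨rfl⟩
    exact inferInstanceAs (T2Space
      {x : (n : ℕ) → d.diagram.Edge n //
        ∀ n, d.diagram.edgeRange n (x n) = d.diagram.edgeSource n (x (n + 1))})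
  let e : X ≃ d.diagram.PathSpace := Equiv.ofBijective d.code ⟨hinj, d.surjective_code⟩
  let Φ : X ≃ₜ d.diagram.PathSpace :=
    Continuous.homeoOfEquivCompactToT2 (f := e) d.continuous_code
  refine ⟨d.diagram, hB, Φ.symm, fun p => ?_⟩
  obtain ⟨x, rfl⟩ := Φ.surjective p
  rw [Φ.symm_apply_apply, Homeomorph.symm_apply_eq]
  exact hcode x

end

end AdicData

/-! ### Towers over clopen subsets -/

/-- The total time of the first `n` returns of a point, for the return time `ret` and the return
map `R`. -/
def totalTime {Z : Type*} (ret : Z → ℕ) (R : Z → Z) (n : ℕ) (z : Z) : ℕ :=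
  ∑ i ∈ Finset.range n, ret (R^[i] z)

/-- `(Y, S)` is a tower over the subset `ψ(Z)`: `ret` is the return time, `R` the return map, and
`y` is the point at height `ht y` over `base y`. -/
structure Tower {Y Z : Type*} [TopologicalSpace Y] [TopologicalSpace Z]
    (S : Y → Y) (ψ : Z → Y) where
  ret : Z → ℕ
  R : Z → Z
  base : Y → Z
  ht : Y → ℕ
  ret_pos : ∀ z, 0 < ret z
  iterate_ret : ∀ z, S^[ret z] (ψ z) = ψ (R z)
  notMem : ∀ z j, 0 < j → j < ret z → S^[j] (ψ z) ∉ Set.range ψ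
  continuous_ret : Continuous ret
  continuous_R : Continuous R
  continuous_base : Continuous base
  continuous_ht : Continuous ht
  iterate_ht : ∀ y, S^[ht y] (ψ (base y)) = y
  ht_lt : ∀ y, ht y < ret (base y)
  base_iterate : ∀ z n, n < ret z → base (S^[n] (ψ z)) = z
  ht_iterate : ∀ z n, n < ret z → ht (S^[n] (ψ z)) = n

theorem continuous_iterate_apply {W Y : Type*} [TopologicalSpace W] [TopologicalSpace Y]
    {S : Y → Y} (hS : Continuous S) {n : W → ℕ} (hn : Continuous n) {f : W → Y}
    (hf : Continuous f) : Continuous fun p => S^[n p] (f p) :=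
  (continuous_prod_of_discrete_left (f := fun q : ℕ × Y => S^[q.1] q.2)).2
    (fun k => hS.iterate k) |>.comp (hn.prodMk hf)

namespace Tower

/-- Two points of the base that meet at heights below their return times are equal, if `S` is
injective away from the base. -/
theorem height_unique {Y Z : Type*} {S : Y → Y} {ψ : Z → Y} (hψ : Function.Injective ψ)
    (hS : ∀ y y', S y = S y' → S y ∉ Set.range ψ → y = y') (ret : Z → ℕ)
    (hret : ∀ z j, 0 < j → j < ret z → S^[j] (ψ z) ∉ Set.range ψ) :
    ∀ n n' z z', n < ret z → n' < ret z' → S^[n] (ψ z) = S^[n'] (ψ z') → n = n' ∧ z = z' := by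
  intro n
  induction n with
  | zero =>
    intro n' z z' _ hn' h
    rcases Nat.eq_zero_or_pos n' with rfl | h0
    · exact ⟨rfl, hψ h⟩
    · exact absurd ⟨z, h⟩ (hret z' n' h0 hn')
  | succ n ih =>
    intro n' z z' hn hn' h
    rcases n' with _ | n'
    · exact absurd ⟨z', h.symm⟩ (hret z (n + 1) n.succ_pos hn)
    · have h0 := hret z (n + 1) n.succ_pos hn
      rw [Function.iterate_succ_apply'] at h0
      rw [Function.iterate_succ_apply', Function.iterate_succ_apply'] at h
      obtain ⟨rfl, rfl⟩ := ih n' z z' (by omega) (by omega) (hS _ _ h h0)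
      exact ⟨rfl, rfl⟩

variable {Y Z : Type*} [TopologicalSpace Y] [TopologicalSpace Z] {S : Y → Y} {ψ : Z → Y}

theorem exists_bounded_hit {Y : Type*} [TopologicalSpace Y] {S : Y → Y} [CompactSpace Y] (hS : Continuous S) (U : Set Y) (hU : IsOpen U)
    (hhit : ∀ y, ∃ n, S^[n] y ∈ U) : ∃ N, ∀ y, ∃ n ≤ N, S^[n] y ∈ U := by
  obtain ⟨t, ht⟩ := isCompact_univ.elim_finite_subcover (fun n => S^[n] ⁻¹' U)
    (fun n => hU.preimage (hS.iterate n)) (fun y _ => Set.mem_iUnion.2 (hhit y))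
  refine ⟨t.sup id, fun y => ?_⟩
  obtain ⟨n, hn, hy⟩ := Set.mem_iUnion₂.1 (ht (Set.mem_univ y))
  exact ⟨n, Finset.le_sup (f := id) hn, hy⟩

/-- The pairs (base point, height below the return time) form a compact space that maps continuously
and bijectively onto Y, so base and height depend continuously on the point of Y. -/
theorem exists_tower [CompactSpace Y] [T2Space Y] [CompactSpace Z]
    [T2Space Z] (hS : Continuous S) (hψ : Continuous ψ) (hinj : Function.Injective ψ)
    (hopen : IsOpen (Set.range ψ)) (hsurj : Function.Surjective S)
    (hSinj : ∀ y y', S y = S y' → S y ∉ Set.range ψ → y = y')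
    (hhit : ∀ y, ∃ n, S^[n] y ∈ Set.range ψ) : Nonempty (Tower S ψ) := by
  classical
  have hcl : IsClopen (Set.range ψ) := ⟨(isCompact_range hψ).isClosed, hopen⟩
  obtain ⟨N, hN⟩ := exists_bounded_hit hS _ hopen hhit
  have hex : ∀ z, ∃ n, 0 < n ∧ S^[n] (ψ z) ∈ Set.range ψ := fun z => by
    obtain ⟨n, hn⟩ := hhit (S (ψ z))
    exact ⟨n + 1, n.succ_pos, by rwa [Function.iterate_succ_apply]⟩
  let ret : Z → ℕ := fun z => Nat.find (hex z)
  have hret_pos : ∀ z, 0 < ret z := fun z => (Nat.find_spec (hex z)).1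
  have hret_mem : ∀ z, S^[ret z] (ψ z) ∈ Set.range ψ := fun z => (Nat.find_spec (hex z)).2
  have hret_not : ∀ z j, 0 < j → j < ret z → S^[j] (ψ z) ∉ Set.range ψ := fun z j hj hlt hm =>
    Nat.find_min (hex z) hlt ⟨hj, hm⟩
  have hret_le : ∀ z, ret z ≤ N + 1 := fun z => by
    obtain ⟨n, hn, hm⟩ := hN (S (ψ z))
    refine (Nat.find_min' (hex z) ⟨n.succ_pos, ?_⟩).trans (Nat.succ_le_succ hn)
    rwa [Function.iterate_succ_apply]
  have hcont : ∀ n, Continuous fun z => S^[n] (ψ z) := fun n => (hS.iterate n).comp hψ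
  have hret_cont : Continuous ret := by
    refine ((IsLocallyConstant.iff_eventually_eq _).2 fun z => ?_).continuous
    have h1 : ∀ᶠ z' in nhds z, S^[ret z] (ψ z') ∈ Set.range ψ :=
      (hcont _).continuousAt.eventually_mem (hopen.mem_nhds (hret_mem z))
    have h2 : ∀ᶠ z' in nhds z, ∀ j ∈ Finset.Ioo 0 (ret z), S^[j] (ψ z') ∉ Set.range ψ := by
      refine (Filter.eventually_all_finset _).2 fun j hj => ?_
      rw [Finset.mem_Ioo] at hj
      exact (hcont j).continuousAt.eventually_mem
        (hcl.compl.isOpen.mem_nhds (hret_not z j hj.1 hj.2))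
    filter_upwards [h1, h2] with z' h1 h2
    refine (Nat.find_eq_iff _).2 ⟨⟨hret_pos z, h1⟩, fun j hj hj' => ?_⟩
    exact h2 j (Finset.mem_Ioo.2 ⟨hj'.1, hj⟩) hj'.2
  let eψ : Z ≃ₜ Set.range ψ := (hψ.isClosedEmbedding hinj).isEmbedding.toHomeomorph
  have heψ : ∀ y, ψ (eψ.symm y) = y.1 := fun y => congrArg Subtype.val (eψ.apply_symm_apply y)
  -- Compact, because the return times are bounded by N + 1 and continuous.
  let W : Type _ := {p : Z × ℕ // p.2 < ret p.1}
  have hWc : CompactSpace W := by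
    refine isCompact_iff_compactSpace.1 (IsCompact.of_isClosed_subset
      (isCompact_univ.prod (Set.finite_Iic (N + 1)).isCompact)
      ((isClosed_discrete {q : ℕ × ℕ | q.2 < q.1}).preimage
        ((hret_cont.comp continuous_fst).prodMk continuous_snd)) fun p hp => ⟨trivial, ?_⟩)
    exact (le_of_lt hp).trans (hret_le p.1)
  let g : W → Y := fun p => S^[p.1.2] (ψ p.1.1)
  have hg : Continuous g :=
    continuous_iterate_apply hS (continuous_snd.comp continuous_subtype_val)
      (hψ.comp (continuous_fst.comp continuous_subtype_val))
  have hgb : Function.Bijective g := by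
    constructor
    · rintro ⟨⟨z, n⟩, hn⟩ ⟨⟨z', n'⟩, hn'⟩ h
      obtain ⟨rfl, rfl⟩ := height_unique hinj hSinj ret hret_not n n' z z' hn hn' h
      rfl
    · intro y
      -- Go back N steps, far enough to meet the base. If q ≤ N is the time of the last visit, y has
      -- height N - q over the point visited.
      obtain ⟨y', rfl⟩ := (hsurj.iterate N) y
      have hlast := Nat.findGreatest_spec (P := fun j => S^[j] y' ∈ Set.range ψ)
        (hN y').choose_spec.1 (hN y').choose_spec.2
      have hmax := fun k => Nat.findGreatest_is_greatest (k := k)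
        (P := fun j => S^[j] y' ∈ Set.range ψ) (n := N)
      have hle := Nat.findGreatest_le (P := fun j => S^[j] y' ∈ Set.range ψ) N
      generalize Nat.findGreatest (fun j => S^[j] y' ∈ Set.range ψ) N = q at *
      obtain ⟨z, hz⟩ := hlast
      refine ⟨⟨(z, N - q), ?_⟩, ?_⟩
      · by_contra hlt
        simp only [not_lt] at hlt
        refine hmax (ret z + q) (by have := hret_pos z; omega) (by omega) ?_
        rw [Function.iterate_add_apply, ← hz]
        exact hret_mem z
      · change S^[N - q] (ψ z) = _
        rw [hz, ← Function.iterate_add_apply, Nat.sub_add_cancel hle]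
  let Φ : W ≃ₜ Y := Continuous.homeoOfEquivCompactToT2 (f := Equiv.ofBijective g hgb) hg
  have hΦ : ∀ y, g (Φ.symm y) = y := Φ.apply_symm_apply
  have hΦ' : ∀ z n (h : n < ret z), Φ.symm (S^[n] (ψ z)) = ⟨(z, n), h⟩ := fun z n h =>
    Φ.symm_apply_apply ⟨(z, n), h⟩
  refine ⟨{
    ret := ret
    R := fun z => eψ.symm ⟨S^[ret z] (ψ z), hret_mem z⟩
    base := fun y => (Φ.symm y).1.1
    ht := fun y => (Φ.symm y).1.2
    ret_pos := hret_pos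
    iterate_ret := fun z => (heψ ⟨_, hret_mem z⟩).symm
    notMem := hret_not
    continuous_ret := hret_cont
    continuous_R := ?_
    continuous_base := continuous_fst.comp (continuous_subtype_val.comp Φ.symm.continuous)
    continuous_ht := continuous_snd.comp (continuous_subtype_val.comp Φ.symm.continuous)
    iterate_ht := hΦ
    ht_lt := fun y => (Φ.symm y).2
    base_iterate := fun z n h => by rw [hΦ' z n h]
    ht_iterate := fun z n h => by rw [hΦ' z n h] }⟩
  refine eψ.symm.continuous.comp (Continuous.subtype_mk ?_ _)
  exact continuous_iterate_apply hS hret_cont hψ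

variable (t : Tower S ψ)

theorem base_iterate_zero (z : Z) : t.base (ψ z) = z := t.base_iterate z 0 (t.ret_pos z)

theorem ht_iterate_zero (z : Z) : t.ht (ψ z) = 0 := t.ht_iterate z 0 (t.ret_pos z)

theorem base_succ (y : Y) (h : t.ht y + 1 < t.ret (t.base y)) :
    t.base (S y) = t.base y ∧ t.ht (S y) = t.ht y + 1 := by
  have h1 : S^[t.ht y + 1] (ψ (t.base y)) = S y := by
    rw [Function.iterate_succ_apply', t.iterate_ht]
  exact ⟨h1 ▸ t.base_iterate _ _ h, h1 ▸ t.ht_iterate _ _ h⟩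

theorem base_top (y : Y) (h : t.ht y + 1 = t.ret (t.base y)) :
    t.base (S y) = t.R (t.base y) ∧ t.ht (S y) = 0 := by
  have h1 : ψ (t.R (t.base y)) = S y := by
    rw [← t.iterate_ret, ← h, Function.iterate_succ_apply', t.iterate_ht]
  rw [← h1]
  exact ⟨t.base_iterate_zero _, t.ht_iterate_zero _⟩

theorem ret_le {z : Z} {n : ℕ} (hn : 0 < n) (h : S^[n] (ψ z) ∈ Set.range ψ) : t.ret z ≤ n := by
  by_contra hlt
  exact t.notMem z n hn (not_le.1 hlt) h

theorem iterate_totalTime (n : ℕ) (z : Z) :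
    S^[totalTime t.ret t.R n z] (ψ z) = ψ (t.R^[n] z) := by
  induction n with
  | zero => rfl
  | succ n ih =>
    rw [totalTime, Finset.sum_range_succ, add_comm, Function.iterate_add_apply]
    change S^[_] (S^[totalTime t.ret t.R n z] (ψ z)) = _
    rw [ih, t.iterate_ret, Function.iterate_succ_apply']

theorem totalTime_succ (n : ℕ) (z : Z) :
    totalTime t.ret t.R (n + 1) z = totalTime t.ret t.R n z + t.ret (t.R^[n] z) :=
  Finset.sum_range_succ _ _

theorem strictMono_totalTime (z : Z) : StrictMono fun n => totalTime t.ret t.R n z :=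
  strictMono_nat_of_lt_succ fun n => by
    rw [totalTime_succ]
    exact Nat.lt_add_of_pos_right (t.ret_pos _)

/-- Every visit of the orbit of `ψ z` to `ψ(Z)` is an iterated return. -/
theorem exists_eq_totalTime (n : ℕ) : ∀ z, S^[n] (ψ z) ∈ Set.range ψ →
    ∃ q, n = totalTime t.ret t.R q z := by
  induction n using Nat.strong_induction_on with
  | _ n ih =>
    intro z h
    rcases Nat.eq_zero_or_pos n with rfl | h0
    · exact ⟨0, rfl⟩
    have hle := t.ret_le h0 h
    obtain ⟨k, rfl⟩ := Nat.exists_eq_add_of_le' hle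
    have hpos := t.ret_pos z
    rw [Function.iterate_add_apply, t.iterate_ret] at h
    obtain ⟨q, hq⟩ := ih k (by omega) _ h
    refine ⟨q + 1, ?_⟩
    rw [totalTime, Finset.sum_range_succ', hq]
    rfl

/-- If two returns end at the same point other than w, the points just before the return coincide,
and uniqueness of heights traces them to one base point. So the return map is again injective away
from w. -/
theorem injective_R_off (hψ : Function.Injective ψ) (w : Z)
    (hS : ∀ y y', S y = S y' → S y ≠ ψ w → y = y') (z z' : Z) (h : t.R z = t.R z')
    (hw : t.R z ≠ w) : z = z' := by
  have hlast : ∀ z, ∃ n, t.ret z = n + 1 := fun z => Nat.exists_eq_succ_of_ne_zero (t.ret_pos z).ne'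
  obtain ⟨n, hn⟩ := hlast z
  obtain ⟨n', hn'⟩ := hlast z'
  have h1 := t.iterate_ret z
  have h2 := t.iterate_ret z'
  rw [hn, Function.iterate_succ_apply'] at h1
  rw [hn', Function.iterate_succ_apply'] at h2
  have h3 := hS _ _ (h1.trans ((congrArg ψ h).trans h2.symm)) (by rw [h1]; exact hψ.ne hw)
  exact (height_unique hψ (fun y y' hy hy' => hS y y' hy fun hw' => hy' ⟨w, hw'.symm⟩)
    t.ret t.notMem n n' z z' (by omega) (by omega) h3).2

theorem surjective_R (hsurj : Function.Surjective S) : Function.Surjective t.R := by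
  intro z
  obtain ⟨y, hy⟩ := hsurj (ψ z)
  have hlt := t.ht_lt y
  refine ⟨t.base y, ?_⟩
  rcases Nat.lt_or_ge (t.ht y + 1) (t.ret (t.base y)) with h | h
  · have := (t.base_succ y h).2
    rw [hy, t.ht_iterate_zero] at this
    omega
  · have := (t.base_top y (by omega)).1
    rw [hy, t.base_iterate_zero] at this
    exact this.symm

end Tower

/-! ### Sequences agreeing on a prefix -/

/-- The sequences `x` and `y` have the same prefix of length `m`. -/
def AgreeUpTo {A : Type*} (m : ℕ) (x y : ℕ → A) : Prop := ∀ i < m, x i = y i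

namespace AgreeUpTo

variable {A : Type*} {m n : ℕ} {x y z : ℕ → A}

theorem symm (h : AgreeUpTo m x y) : AgreeUpTo m y x := fun i hi => (h i hi).symm

theorem trans (h : AgreeUpTo m x y) (h' : AgreeUpTo m y z) : AgreeUpTo m x z :=
  fun i hi => (h i hi).trans (h' i hi)

theorem mono (h : AgreeUpTo m x y) (hn : n ≤ m) : AgreeUpTo n x y :=
  fun i hi => h i (lt_of_lt_of_le hi hn)

theorem refl (m : ℕ) (x : ℕ → A) : AgreeUpTo m x x := fun _ _ => rfl

end AgreeUpTo

section Shift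

variable {A : Type*}

theorem iterate_seqShift_apply (n i : ℕ) (x : ℕ → A) : seqShift^[n] x i = x (n + i) := by
  induction n generalizing x with
  | zero => simp
  | succ n ih => rw [Function.iterate_succ_apply, ih]; simp only [seqShift]; congr 1; omega

theorem AgreeUpTo.shift {m n : ℕ} {x y : ℕ → A} (h : AgreeUpTo (n + m) x y) :
    AgreeUpTo m (seqShift^[n] x) (seqShift^[n] y) := fun i hi => by
  rw [iterate_seqShift_apply, iterate_seqShift_apply]
  exact h _ (by omega)

theorem AgreeUpTo.of_shift {m n : ℕ} {x y : ℕ → A} (h₀ : AgreeUpTo n x y)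
    (h : AgreeUpTo m (seqShift^[n] x) (seqShift^[n] y)) : AgreeUpTo (n + m) x y := fun i hi => by
  rcases Nat.lt_or_ge i n with hin | hin
  · exact h₀ i hin
  · have := h (i - n) (by omega)
    rwa [iterate_seqShift_apply, iterate_seqShift_apply, Nat.add_sub_cancel' hin] at this

theorem eq_of_forall_agreeUpTo {x y : ℕ → A} (h : ∀ m, AgreeUpTo m x y) : x = y :=
  funext fun i => h (i + 1) i i.lt_succ_self

end Shift

/-! ### Prefixes and the product topology -/

section Topology

theorem iterate_mem_generatedSubshift {A : Type*} [TopologicalSpace A] {u x : ℕ → A} (hx : x ∈ generatedSubshift u) (n : ℕ) :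
    seqShift^[n] x ∈ generatedSubshift u := (mapsTo_seqShift u).iterate n hx

theorem self_mem_generatedSubshift {A : Type*} [TopologicalSpace A] (u : ℕ → A) : u ∈ generatedSubshift u :=
  subset_closure ⟨0, rfl⟩

variable {A : Type*} [TopologicalSpace A] [DiscreteTopology A]

theorem isClopen_agreeUpTo (m : ℕ) (x : ℕ → A) : IsClopen {y | AgreeUpTo m y x} := by
  have : {y | AgreeUpTo m y x} = ⋂ i ∈ Finset.range m, (fun y : ℕ → A => y i) ⁻¹' {x i} := by
    ext; simp [AgreeUpTo]
  rw [this]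
  exact isClopen_biInter_finset fun i _ => (isClopen_discrete _).preimage (continuous_apply i)

theorem exists_agreeUpTo_subset {U : Set (ℕ → A)} {x : ℕ → A} (hU : U ∈ nhds x) :
    ∃ m, ∀ y, AgreeUpTo m y x → y ∈ U := by
  obtain ⟨_, ⟨y, n, rfl⟩, hx, hsub⟩ :=
    (PiNat.isTopologicalBasis_cylinders fun _ : ℕ => A).mem_nhds_iff.1 hU
  exact ⟨n, fun z hz => hsub fun i hi => (hz i hi).trans (hx i hi)⟩

theorem mem_closure_iff_agreeUpTo {s : Set (ℕ → A)} {x : ℕ → A} :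
    x ∈ closure s ↔ ∀ m, ∃ y ∈ s, AgreeUpTo m y x := by
  rw [mem_closure_iff_nhds]
  constructor
  · intro h m
    obtain ⟨y, hy, hs⟩ := h _ ((isClopen_agreeUpTo m x).isOpen.mem_nhds (AgreeUpTo.refl m x))
    exact ⟨y, hs, hy⟩
  · intro h U hU
    obtain ⟨m, hm⟩ := exists_agreeUpTo_subset hU
    obtain ⟨y, hs, hy⟩ := h m
    exact ⟨y, hm y hy, hs⟩

theorem mem_generatedSubshift_iff {u x : ℕ → A} :
    x ∈ generatedSubshift u ↔ ∀ m, ∃ n, AgreeUpTo m (seqShift^[n] u) x := by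
  rw [generatedSubshift, mem_closure_iff_agreeUpTo]
  simp

end Topology

/-! ### Substitutions acting on sequences -/

section Subst

variable {A : Type*} {τ : A → List A}

/-- The length of `τ(x₀ ⋯ xₙ₋₁)`. -/
def cut (τ : A → List A) (x : ℕ → A) (n : ℕ) : ℕ := (substWord τ (seqPrefix x n)).length

/-- The infinite concatenation `τ(x₀) τ(x₁) ⋯` (if it is infinite). -/
def substSeq (τ : A → List A) (x : ℕ → A) : ℕ → A :=
  -- If no τ(a) is empty, m + 1 letters have an image of length at least m + 1, and the default `x
  -- 0` is never used.
  fun m => ((substWord τ (seqPrefix x (m + 1)))[m]?).getD (x 0)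

theorem seqPrefix_add (x : ℕ → A) (n k : ℕ) :
    seqPrefix x (n + k) = seqPrefix x n ++ seqPrefix (seqShift^[n] x) k := by
  simp only [seqPrefix, List.range_add, List.map_append, List.map_map]
  congr 1
  refine List.map_congr_left fun i _ => ?_
  rw [iterate_seqShift_apply]
  rfl

theorem AgreeUpTo.seqPrefix_eq {n : ℕ} {x y : ℕ → A} (h : AgreeUpTo n x y) :
    seqPrefix x n = seqPrefix y n :=
  List.map_congr_left fun i hi => h i (List.mem_range.1 hi)

theorem length_seqPrefix (x : ℕ → A) (n : ℕ) : (seqPrefix x n).length = n := by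
  simp [seqPrefix]

theorem agreeUpTo_of_seqPrefix_eq {n : ℕ} {x y : ℕ → A} (h : seqPrefix x n = seqPrefix y n) :
    AgreeUpTo n x y := fun i hi => by
  have := congrArg (fun l : List A => l[i]?) h
  simpa [seqPrefix, hi] using this

theorem substWord_seqPrefix_add (x : ℕ → A) (n k : ℕ) :
    substWord τ (seqPrefix x (n + k)) =
      substWord τ (seqPrefix x n) ++ substWord τ (seqPrefix (seqShift^[n] x) k) := by
  simp [seqPrefix_add, substWord]

theorem cut_add (x : ℕ → A) (n k : ℕ) :
    cut τ x (n + k) = cut τ x n + cut τ (seqShift^[n] x) k := by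
  simp [cut, substWord_seqPrefix_add]

theorem cut_zero (x : ℕ → A) : cut τ x 0 = 0 := rfl

theorem cut_one (x : ℕ → A) : cut τ x 1 = (τ (x 0)).length := by
  simp [cut, substWord, seqPrefix]

theorem cut_succ (x : ℕ → A) (n : ℕ) : cut τ x (n + 1) = cut τ x n + (τ (x n)).length := by
  rw [cut_add, cut_one, iterate_seqShift_apply, add_zero]

theorem AgreeUpTo.cut_eq {n k : ℕ} {x y : ℕ → A} (h : AgreeUpTo n x y) (hk : k ≤ n) :
    cut τ x k = cut τ y k := by
  rw [cut, cut, (h.mono hk).seqPrefix_eq]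

variable (hne : ∀ a, τ a ≠ [])
include hne

theorem strictMono_cut (x : ℕ → A) : StrictMono (cut τ x) :=
  strictMono_nat_of_lt_succ fun n => by
    rw [cut_succ]
    exact Nat.lt_add_of_pos_right (List.length_pos_iff.2 (hne _))

theorem le_cut (x : ℕ → A) (n : ℕ) : n ≤ cut τ x n := (strictMono_cut hne x).le_apply

theorem getElem?_substWord (x : ℕ → A) {n m : ℕ} (hm : m < cut τ x n) :
    (substWord τ (seqPrefix x n))[m]? = some (substSeq τ x m) := by
  have h1 : m < cut τ x (m + 1) := lt_of_lt_of_le m.lt_succ_self (le_cut hne x _)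
  have h2 : (substWord τ (seqPrefix x (m + 1)))[m]? = some (substSeq τ x m) := by
    rw [substSeq, List.getElem?_eq_getElem h1]
    rfl
  rcases le_total n (m + 1) with h | h
  · obtain ⟨k, hk⟩ := Nat.exists_eq_add_of_le h
    rw [← h2, hk, substWord_seqPrefix_add, List.getElem?_append_left hm]
  · obtain ⟨k, rfl⟩ := Nat.exists_eq_add_of_le h
    rw [substWord_seqPrefix_add, List.getElem?_append_left h1, h2]

theorem substSeq_cut_add (x : ℕ → A) (n j : ℕ) :
    substSeq τ x (cut τ x n + j) = substSeq τ (seqShift^[n] x) j := by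
  have h1 := le_cut hne (seqShift^[n] x) (j + 1)
  have h2 := getElem?_substWord hne x (n := n + (j + 1)) (m := cut τ x n + j)
    (by rw [cut_add]; omega)
  rw [substWord_seqPrefix_add,
    List.getElem?_append_right (show (substWord τ (seqPrefix x n)).length ≤ cut τ x n + j from
      Nat.le_add_right _ _), ← cut, Nat.add_sub_cancel_left, getElem?_substWord hne _ (by omega)] at h2
  exact (Option.some.inj h2).symm

theorem iterate_cut_substSeq (x : ℕ → A) (n : ℕ) :
    seqShift^[cut τ x n] (substSeq τ x) = substSeq τ (seqShift^[n] x) :=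
  funext fun j => by rw [iterate_seqShift_apply, substSeq_cut_add hne]

theorem AgreeUpTo.map {n : ℕ} {x y : ℕ → A} (h : AgreeUpTo n x y) :
    AgreeUpTo (cut τ x n) (substSeq τ x) (substSeq τ y) := fun i hi => by
  have h1 := getElem?_substWord hne x hi
  rw [h.cut_eq le_rfl] at hi
  have h2 := getElem?_substWord hne y hi
  rw [h.seqPrefix_eq, h2] at h1
  exact (Option.some.inj h1).symm

theorem AgreeUpTo.map_of_le {n : ℕ} {x y : ℕ → A} (h : AgreeUpTo n x y) :
    AgreeUpTo n (substSeq τ x) (substSeq τ y) :=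
  (h.map hne).mono (le_cut hne x n)

theorem seqPrefix_substSeq (x : ℕ → A) (n : ℕ) :
    seqPrefix (substSeq τ x) (cut τ x n) = substWord τ (seqPrefix x n) := by
  refine List.ext_getElem? fun i => ?_
  rcases Nat.lt_or_ge i (cut τ x n) with h | h
  · rw [getElem?_substWord hne x h]
    simp [seqPrefix, h]
  · rw [List.getElem?_eq_none h, List.getElem?_eq_none (by simpa [seqPrefix] using h)]

theorem IsSubstImage.eq_substSeq {x y : ℕ → A} (h : IsSubstImage τ x y) : substSeq τ x = y := by
  funext m
  have h1 : m < cut τ x (m + 1) := lt_of_lt_of_le m.lt_succ_self (le_cut hne x _)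
  have h2 := getElem?_substWord hne x h1
  rw [h.1, ← cut] at h2
  simpa only [seqPrefix, List.getElem?_map, List.getElem?_range h1, Option.map_some,
    Option.some.injEq] using h2.symm

/-- The word `τ(x₀)` is determined by its length and `τ(x)`. -/
theorem subst_apply_zero_eq {x y : ℕ → A} (h : substSeq τ x = substSeq τ y)
    (hl : cut τ x 1 = cut τ y 1) : τ (x 0) = τ (y 0) := by
  have h1 := seqPrefix_substSeq hne x 1
  rw [h, hl, seqPrefix_substSeq hne y 1] at h1
  simpa [substWord, seqPrefix] using h1.symm

theorem continuous_substSeq [TopologicalSpace A] [DiscreteTopology A] :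
    Continuous (substSeq τ) := by
  refine continuous_pi fun m => IsLocallyConstant.continuous ?_
  refine (IsLocallyConstant.iff_eventually_eq _).2 fun x => ?_
  filter_upwards [(isClopen_agreeUpTo (m + 1) x).isOpen.mem_nhds (AgreeUpTo.refl _ x)] with y hy
  exact hy.map_of_le hne m m.lt_succ_self

end Subst

/-! ### Minimality and recognizability of the subshift of a fixed point -/

section FixedPoint

variable {A : Type*} {τ : A → List A} {u : ℕ → A}

theorem substPow_one (a : A) : substPow τ 1 a = τ a := by simp [substPow, substWord]

theorem cut_le_mul {Λ : ℕ} (hΛ : ∀ a, (τ a).length ≤ Λ) (x : ℕ → A) (n : ℕ) :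
    cut τ x n ≤ Λ * n := by
  induction n with
  | zero => exact le_rfl
  | succ n ih =>
    rw [cut_succ, Nat.mul_succ]
    exact Nat.add_le_add ih (hΛ _)

theorem exists_length_le [Finite A] (τ : A → List A) : ∃ Λ, ∀ a, (τ a).length ≤ Λ :=
  Finite.exists_le fun a => (τ a).length

theorem exists_cut_ge (hne : ∀ a, τ a ≠ []) {Λ : ℕ} (hΛ : ∀ a, (τ a).length ≤ Λ) (x : ℕ → A)
    (n : ℕ) : ∃ q, n ≤ cut τ x q ∧ cut τ x q ≤ n + Λ := by
  classical
  have hex : ∃ q, n ≤ cut τ x q := ⟨n, le_cut hne x n⟩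
  refine ⟨Nat.find hex, Nat.find_spec hex, ?_⟩
  rcases h : Nat.find hex with _ | q
  · simp [cut_zero]
  · have h1 := Nat.find_min hex (m := q) (by omega)
    have h2 := hΛ (x q)
    rw [cut_succ]
    omega

theorem substSeq_zero (hne : ∀ a, τ a ≠ []) {l : A} (hl : ∀ a, (τ a).head? = some l) (x : ℕ → A) :
    substSeq τ x 0 = l := by
  have h := getElem?_substWord hne x (n := 1) (m := 0)
    (by rw [cut_one]; exact List.length_pos_iff.2 (hne _))
  rw [← List.head?_eq_getElem?] at h
  have h2 := hl (x 0)
  simp only [substWord, seqPrefix, List.range_one, List.map_cons, List.map_nil,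
    List.flatMap_singleton] at h
  exact Option.some.inj (h.symm.trans h2)

/-- A single letter with a long image already makes the image of the prefix strictly longer. This
drives both the recurrence of prefixes of u and the contraction towards the branch point. -/
theorem lt_cut (hne : ∀ a, τ a ≠ []) (x : ℕ → A) {p m : ℕ} (hx : 2 ≤ (τ (x p)).length)
    (hp : p < m) : m < cut τ x m := by
  obtain ⟨k, rfl⟩ : ∃ k, m = p + 1 + k := Nat.exists_eq_add_of_le hp
  rw [cut_add, cut_succ]
  have := le_cut hne x p
  have := le_cut hne (seqShift^[p + 1] x) k
  omega

/-- Since τ(u) = u, the image of an occurrence of a word in u is an occurrence of its image, located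
at the corresponding cutting. -/
theorem AgreeUpTo.substSeq_shift (hne : ∀ a, τ a ≠ []) (hu : substSeq τ u = u) {m n : ℕ}
    {x : ℕ → A} (h : AgreeUpTo m (seqShift^[n] u) x) :
    AgreeUpTo (cut τ x m) (seqShift^[cut τ u n] u) (substSeq τ x) := by
  have := h.symm.map hne
  rw [← iterate_cut_substSeq hne, hu] at this
  exact this.symm

/-- Every prefix of `u` occurs in `u` with bounded gaps. -/
theorem exists_bounded_gap [Finite A] (hne : ∀ a, τ a ≠ []) (hu : substSeq τ u = u) {l : A}
    (hl : ∀ a, (τ a).head? = some l) (hgrow : 2 ≤ (τ (u 0)).length) (m : ℕ) :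
    ∃ G, ∀ n, ∃ i ≤ G, AgreeUpTo m (seqShift^[n + i] u) u := by
  obtain ⟨Λ, hΛ⟩ := exists_length_le τ
  induction m with
  | zero => exact ⟨0, fun n => ⟨0, le_rfl, fun i hi => absurd hi (Nat.not_lt_zero i)⟩⟩
  | succ m ih =>
    obtain ⟨G, hG⟩ := ih
    refine ⟨Λ + Λ * G, fun n => ?_⟩
    obtain ⟨q, hq1, hq2⟩ := exists_cut_ge hne hΛ u n
    obtain ⟨i, hi, hagree⟩ := hG q
    have h1 : cut τ u (q + i) ≤ n + (Λ + Λ * G) := by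
      rw [cut_add]
      have := (cut_le_mul hΛ (seqShift^[q] u) i).trans (Nat.mul_le_mul_left Λ hi)
      omega
    have h2 : n ≤ cut τ u (q + i) := hq1.trans ((strictMono_cut hne u).monotone (by omega))
    refine ⟨cut τ u (q + i) - n, by omega, ?_⟩
    rw [Nat.add_sub_cancel' h2]
    -- An occurrence of the prefix of length m is mapped to one of a longer prefix, because τ(u₀)
    -- has at least two letters. For m = 0 left properness is used instead: the letter at every
    -- cutting is l = u₀.
    rcases Nat.eq_zero_or_pos m with rfl | hm
    · intro j hj
      obtain rfl : j = 0 := by omega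
      have h3 := substSeq_zero hne hl (seqShift^[q + i] u)
      rw [← iterate_cut_substSeq hne, hu] at h3
      rw [h3, ← hu, substSeq_zero hne hl]
    · have h3 := hagree.substSeq_shift hne hu
      rw [hu] at h3
      exact h3.mono (lt_cut hne u hgrow hm)

theorem iterate_seqShift_inj [TopologicalSpace A] (hap : IsAperiodicSubshift u) {x : ℕ → A}
    (hx : x ∈ generatedSubshift u) {i j : ℕ} (h : seqShift^[i] x = seqShift^[j] x) : i = j := by
  by_contra hij
  wlog hlt : i < j generalizing i j
  · exact this h.symm (Ne.symm hij) (by omega)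
  refine hap _ (iterate_mem_generatedSubshift hx i) ⟨j - i, by omega, ?_⟩
  rw [Function.IsPeriodicPt, Function.IsFixedPt, ← Function.iterate_add_apply,
    Nat.sub_add_cancel hlt.le, h]

/-- Otherwise τ fixes the letter u₀, primitivity leaves no other letter, and u is constant. -/
theorem two_le_length [TopologicalSpace A] (hne : ∀ a, τ a ≠ []) (hu : substSeq τ u = u) {l : A}
    (hl : ∀ a, (τ a).head? = some l) (hprim : IsPrimitiveSubst τ) (hap : IsAperiodicSubshift u) :
    2 ≤ (τ (u 0)).length := by
  by_contra hlt
  have hlen : (τ (u 0)).length = 1 := by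
    have := List.length_pos_iff.2 (hne (u 0))
    omega
  obtain ⟨b, hb⟩ := List.length_eq_one_iff.1 hlen
  have hb' : τ (u 0) = [u 0] := by
    have h1 := hl (u 0)
    rw [hb, List.head?_singleton, Option.some.injEq] at h1
    have h2 := substSeq_zero hne hl u
    rw [hu] at h2
    rw [hb, h1, h2]
  obtain ⟨k, -, hk⟩ := hprim
  have hfix : ∀ k, substPow τ k (u 0) = [u 0] := fun k => by
    refine Function.iterate_fixed ?_ k
    simpa [substWord] using hb'
  have hall : ∀ c, c = u 0 := fun c => by
    have := hk (u 0) c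
    rwa [hfix, List.mem_singleton] at this
  have := iterate_seqShift_inj hap (self_mem_generatedSubshift u) (i := 0) (j := 1)
    (funext fun n => (hall _).trans (hall _).symm)
  omega

variable [TopologicalSpace A] [DiscreteTopology A]

theorem isCompact_generatedSubshift {A : Type*} [TopologicalSpace A] [Finite A] (u : ℕ → A) : IsCompact (generatedSubshift u) :=
  isClosed_closure.isCompact

/-- The subshift of `u` is minimal. -/
theorem exists_iterate_agreeUpTo [Finite A] (hne : ∀ a, τ a ≠ []) (hu : substSeq τ u = u) {l : A}
    (hl : ∀ a, (τ a).head? = some l) (hgrow : 2 ≤ (τ (u 0)).length) {x y : ℕ → A}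
    (hx : x ∈ generatedSubshift u) (hy : y ∈ generatedSubshift u) (m : ℕ) :
    ∃ n, AgreeUpTo m (seqShift^[n] x) y := by
  obtain ⟨q, hq⟩ := mem_generatedSubshift_iff.1 hy m
  -- The prefix of u of length q + m contains the wanted word at position q, and recurs with gaps
  -- bounded by G.
  obtain ⟨G, hG⟩ := exists_bounded_gap hne hu hl hgrow (q + m)
  obtain ⟨n, hn⟩ := mem_generatedSubshift_iff.1 hx (G + (q + m))
  obtain ⟨i, hi, hagree⟩ := hG n
  have h1 : AgreeUpTo (q + m) (seqShift^[i] x) (seqShift^[i] (seqShift^[n] u)) :=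
    ((hn.mono (show i + (q + m) ≤ _ by omega)).symm).shift
  rw [← Function.iterate_add_apply, add_comm i n] at h1
  refine ⟨q + i, ?_⟩
  rw [Function.iterate_add_apply]
  exact (h1.trans hagree).shift.trans hq

/-- The image of the shift is compact and contains the orbit of σ(u), which is dense by minimality.
-/
theorem exists_seqShift_eq [Finite A] (hne : ∀ a, τ a ≠ []) (hu : substSeq τ u = u) {l : A}
    (hl : ∀ a, (τ a).head? = some l) (hgrow : 2 ≤ (τ (u 0)).length) {x : ℕ → A}
    (hx : x ∈ generatedSubshift u) : ∃ y ∈ generatedSubshift u, seqShift y = x := by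
  have hcl : IsClosed (seqShift '' generatedSubshift u) :=
    ((isCompact_generatedSubshift u).image continuous_seqShift).isClosed
  change x ∈ seqShift '' generatedSubshift u
  rw [← hcl.closure_eq, mem_closure_iff_agreeUpTo]
  intro m
  obtain ⟨n, hn⟩ := exists_iterate_agreeUpTo hne hu hl hgrow
    (iterate_mem_generatedSubshift (self_mem_generatedSubshift u) 1) hx m
  refine ⟨_, ⟨_, iterate_mem_generatedSubshift (self_mem_generatedSubshift u) n, rfl⟩, ?_⟩
  rwa [← Function.iterate_add_apply, add_comm, Function.iterate_add_apply] at hn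

theorem substSeq_mem (hne : ∀ a, τ a ≠ []) (hu : substSeq τ u = u) {x : ℕ → A}
    (hx : x ∈ generatedSubshift u) : substSeq τ x ∈ generatedSubshift u := by
  refine mem_generatedSubshift_iff.2 fun m => ?_
  obtain ⟨n, hn⟩ := mem_generatedSubshift_iff.1 hx m
  exact ⟨_, (hn.substSeq_shift hne hu).mono (le_cut hne x m)⟩

/-- The subset `τ(X)` of the subshift `X` is open. -/
theorem exists_mem_of_agreeUpTo_substSeq [Finite A] (hne : ∀ a, τ a ≠ []) (hu : substSeq τ u = u)
    (hrec : IsRecognizable τ u) : ∃ L, ∀ y z, y ∈ generatedSubshift u → z ∈ generatedSubshift u →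
      AgreeUpTo L z (substSeq τ y) → z ∈ substSeq τ '' generatedSubshift u := by
  obtain ⟨L, hL⟩ := hrec
  refine ⟨L, fun y z hy hz h => ?_⟩
  have hcl : IsClosed (substSeq τ '' generatedSubshift u) :=
    ((isCompact_generatedSubshift u).image (continuous_substSeq hne)).isClosed
  rw [← hcl.closure_eq, mem_closure_iff_agreeUpTo]
  intro m
  obtain ⟨n, hn⟩ := mem_generatedSubshift_iff.1 hy L
  have h1 := (hn.substSeq_shift hne hu).mono (le_cut hne y L)
  obtain ⟨k, hk⟩ := mem_generatedSubshift_iff.1 hz (max m L)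
  have h2 : AgreeUpTo L (seqShift^[cut τ u n] u) (seqShift^[k] u) :=
    (h1.trans h.symm).trans (hk.mono (le_max_right _ _)).symm
  -- Recognizability makes k, where u imitates z, a cutting; the tail of u from there is the image
  -- of a tail of u.
  obtain ⟨q, rfl⟩ := hL (cut τ u n) k (fun i hi => by
    simpa only [iterate_seqShift_apply] using h2 i hi) ⟨n, rfl⟩
  refine ⟨_, ⟨_, iterate_mem_generatedSubshift (self_mem_generatedSubshift u) q, rfl⟩, ?_⟩
  rw [← iterate_cut_substSeq hne, hu]
  exact hk.mono (le_max_left _ _)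

/-- Recognizability is a property of u, transferred to the subshift by approximation: y and x are
imitated by u at n and k, so the cutting at the image of n forces one at distance j from the image
of k. Since a cut is at least its index, the cut at j is visible in the part of x that is imitated.
-/
theorem exists_eq_cut (hne : ∀ a, τ a ≠ []) (hu : substSeq τ u = u)
    (hrec : IsRecognizable τ u) {x y : ℕ → A} (hx : x ∈ generatedSubshift u)
    (hy : y ∈ generatedSubshift u) {j : ℕ} (h : seqShift^[j] (substSeq τ x) = substSeq τ y) :
    ∃ q, j = cut τ x q := by
  obtain ⟨L, hL⟩ := hrec
  obtain ⟨n, hn⟩ := mem_generatedSubshift_iff.1 hy L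
  have h1 := (hn.substSeq_shift hne hu).mono (le_cut hne y L)
  obtain ⟨k, hk⟩ := mem_generatedSubshift_iff.1 hx (j + L)
  have h2 := ((hk.substSeq_shift hne hu).mono (le_cut hne x _)).shift
  rw [h] at h2
  have h3 := h1.trans h2.symm
  obtain ⟨q, hq⟩ := hL (cut τ u n) (cut τ u k + j) (fun i hi => by
    simpa only [iterate_seqShift_apply, add_assoc] using h3 i hi) ⟨n, rfl⟩
  change cut τ u q = _ at hq
  have hkq : k ≤ q := (strictMono_cut hne u).le_iff_le.1 (by omega)
  obtain ⟨p, rfl⟩ := Nat.exists_eq_add_of_le hkq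
  rw [cut_add, Nat.add_left_cancel_iff] at hq
  have hp := le_cut hne (seqShift^[k] u) p
  exact ⟨p, by rw [← hq]; exact hk.cut_eq (by omega)⟩

/-- The image τ(x) determines its own cuts by `exists_eq_cut`, hence the words τ(xₙ), hence the
letters. -/
theorem injOn_substSeq (hne : ∀ a, τ a ≠ []) (hinj : Function.Injective τ)
    (hu : substSeq τ u = u) (hrec : IsRecognizable τ u) :
    Set.InjOn (substSeq τ) (generatedSubshift u) := by
  intro x hx y hy h
  have hsub : ∀ {x y}, x ∈ generatedSubshift u → y ∈ generatedSubshift u →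
      substSeq τ x = substSeq τ y → Set.range (cut τ y) ⊆ Set.range (cut τ x) := by
    rintro x y hx hy h _ ⟨q, rfl⟩
    obtain ⟨p, hp⟩ := exists_eq_cut hne hu hrec hx (iterate_mem_generatedSubshift hy q)
      (j := cut τ y q) (by rw [h, iterate_cut_substSeq hne])
    exact ⟨p, hp.symm⟩
  have hcut : cut τ x = cut τ y :=
    ((strictMono_cut hne x).range_inj (strictMono_cut hne y)).1
      ((hsub hy hx h.symm).antisymm (hsub hx hy h))
  funext n
  refine hinj ?_
  have := subst_apply_zero_eq hne (x := seqShift^[n] x) (y := seqShift^[n] y)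
    (by rw [← iterate_cut_substSeq hne, ← iterate_cut_substSeq hne, h, hcut])
    (by
      have h1 := cut_add (τ := τ) x n 1
      have h2 := cut_add (τ := τ) y n 1
      rw [hcut] at h1
      omega)
  simpa only [iterate_seqShift_apply, add_zero] using this

end FixedPoint

/-! ### The branch point and the induced self-similar system -/

section Branch

variable {A : Type*} [TopologicalSpace A]

/-- `u` is an aperiodic recognizable fixed point of the left proper substitution `τ`, which is
injective on letters. -/
structure IsAdmissible (τ : A → List A) (u : ℕ → A) : Prop where
  ne_nil : ∀ a, τ a ≠ []
  injective : Function.Injective τ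
  fixed : substSeq τ u = u
  leftProper : IsLeftProper τ
  recognizable : IsRecognizable τ u
  aperiodic : IsAperiodicSubshift u
  two_le : 2 ≤ (τ (u 0)).length

theorem isAdmissible {τ : A → List A} {u : ℕ → A} (hprimitive : IsPrimitiveSubst τ)
    (hinjective : PowersInjective τ) (hfixed : IsSubstFixedPoint τ u)
    (haperiodic : IsAperiodicSubshift u) (hrecognizable : IsRecognizable τ u)
    (hleft : IsLeftProper τ) : IsAdmissible τ u := by
  obtain ⟨l, hl⟩ := hleft
  have hne : ∀ a, τ a ≠ [] := fun a h => by simpa [h] using hl a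
  have hu := IsSubstImage.eq_substSeq hne hfixed
  exact ⟨hne, fun a b h => hinjective 1 (by rwa [substPow_one, substPow_one]), hu, ⟨l, hl⟩,
    hrecognizable, haperiodic, two_le_length hne hu hl hprimitive haperiodic⟩

/-- `w` is the only point of the subshift of `u` with several preimages. -/
structure IsUniqueBranch (u w : ℕ → A) : Prop where
  mem : w ∈ generatedSubshift u
  eq_of_ne : ∀ x ∈ generatedSubshift u, ∀ y ∈ generatedSubshift u, seqShift x = seqShift y →
    seqShift x ≠ w → x = y
  exists_ne : ∃ x ∈ generatedSubshift u, ∃ y ∈ generatedSubshift u, seqShift x = w ∧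
    seqShift y = w ∧ x ≠ y

/-- The sequence `s τ(x)`, where `s` is the prefix of length `j` of `w`. -/
def prependSubst (τ : A → List A) (w : ℕ → A) (j : ℕ) (x : ℕ → A) : ℕ → A :=
  fun n => if n < j then w n else substSeq τ x (n - j)

theorem agreeUpTo_prependSubst (τ : A → List A) (w : ℕ → A) (j : ℕ) (x : ℕ → A) :
    AgreeUpTo j (prependSubst τ w j x) w := fun i hi => by simp [prependSubst, hi]

theorem iterate_prependSubst (τ : A → List A) (w : ℕ → A) (j : ℕ) (x : ℕ → A) :
    seqShift^[j] (prependSubst τ w j x) = substSeq τ x :=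
  funext fun i => by simp [iterate_seqShift_apply, prependSubst]

theorem eq_prependSubst {τ : A → List A} {w : ℕ → A} {j : ℕ} {x y : ℕ → A}
    (h₁ : AgreeUpTo j y w) (h₂ : seqShift^[j] y = substSeq τ x) : y = prependSubst τ w j x := by
  refine eq_of_forall_agreeUpTo fun m => AgreeUpTo.mono (m := j + m) ?_ (by omega)
  refine (h₁.trans (agreeUpTo_prependSubst τ w j x).symm).of_shift ?_
  rw [iterate_prependSubst, h₂]
  exact AgreeUpTo.refl _ _

variable [DiscreteTopology A] {τ : A → List A} {u w : ℕ → A}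

namespace IsAdmissible

variable [Finite A] (hτ : IsAdmissible τ u)
include hτ

theorem exists_agreeUpTo {x y : ℕ → A} (hx : x ∈ generatedSubshift u)
    (hy : y ∈ generatedSubshift u) (m : ℕ) : ∃ n, AgreeUpTo m (seqShift^[n] x) y := by
  obtain ⟨l, hl⟩ := hτ.leftProper
  exact exists_iterate_agreeUpTo hτ.ne_nil hτ.fixed hl hτ.two_le hx hy m

theorem exists_preimage {x : ℕ → A} (hx : x ∈ generatedSubshift u) :
    ∃ y ∈ generatedSubshift u, seqShift y = x := by
  obtain ⟨l, hl⟩ := hτ.leftProper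
  exact exists_seqShift_eq hτ.ne_nil hτ.fixed hl hτ.two_le hx

theorem exists_isUniqueBranch (hquasi : IsQuasiInvertible (subshiftMap u)) :
    ∃ w, IsUniqueBranch u w := by
  obtain ⟨⟨w, hw⟩, hb, huniq⟩ := hquasi
  refine ⟨w, hw, fun x hx y hy hxy hne => ?_, ?_⟩
  · by_contra hne'
    have hbr : IsBranchPoint (subshiftMap u) (subshiftMap u ⟨x, hx⟩) := fun hex =>
      hne' (congrArg Subtype.val (hex.unique (y₁ := ⟨x, hx⟩) (y₂ := ⟨y, hy⟩) rfl
        (Subtype.ext hxy.symm)))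
    exact hne (congrArg Subtype.val (huniq _ hbr))
  · obtain ⟨x, hx, hxw⟩ := hτ.exists_preimage hw
    by_contra hno
    push Not at hno
    exact hb ⟨⟨x, hx⟩, Subtype.ext hxw, fun y hy =>
      Subtype.ext (hno y.1 y.2 x hx (congrArg Subtype.val hy) hxw)⟩

/-- The images of x and y coincide from τ(w) on. Reading backwards they keep coinciding as long as w
is not met, and they cannot coincide throughout the shorter of the two first blocks. -/
theorem exists_common_suffix (hw : IsUniqueBranch u w) {x y : ℕ → A}
    (hx : x ∈ generatedSubshift u) (hy : y ∈ generatedSubshift u) (hxw : seqShift x = w)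
    (hyw : seqShift y = w) (hxy : x ≠ y) :
    ∃ j ≤ (τ (x 0)).length, seqShift^[(τ (x 0)).length - j] (substSeq τ x) = w := by
  have hne := hτ.ne_nil
  -- The statement is made symmetric in x and y so that τ(x₀) may be taken to be the shorter block.
  suffices h : ∃ j ≤ (τ (x 0)).length, j ≤ (τ (y 0)).length ∧
      seqShift^[(τ (x 0)).length - j] (substSeq τ x) = w ∧
      seqShift^[(τ (y 0)).length - j] (substSeq τ y) = w by
    obtain ⟨j, h1, -, h2, -⟩ := h
    exact ⟨j, h1, h2⟩
  wlog hle : (τ (x 0)).length ≤ (τ (y 0)).length generalizing x y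
  · obtain ⟨j, h1, h2, h3, h4⟩ := this hy hx hyw hxw hxy.symm (by omega)
    exact ⟨j, h2, h1, h4, h3⟩
  by_contra hno
  push Not at hno
  rw [← cut_one, ← cut_one] at *
  have hxτ := substSeq_mem hne hτ.fixed hx
  have hyτ := substSeq_mem hne hτ.fixed hy
  have hback : ∀ j ≤ cut τ x 1, seqShift^[cut τ x 1 - j] (substSeq τ x) =
      seqShift^[cut τ y 1 - j] (substSeq τ y) := by
    intro j
    induction j with
    | zero =>
      intro _
      rw [Nat.sub_zero, Nat.sub_zero, iterate_cut_substSeq hne, iterate_cut_substSeq hne]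
      exact congrArg _ (hxw.trans hyw.symm)
    | succ j ih =>
      intro hj
      have h1 := ih (by omega)
      obtain ⟨p, hp⟩ : ∃ p, cut τ x 1 - (j + 1) = p := ⟨_, rfl⟩
      obtain ⟨q, hq⟩ : ∃ q, cut τ y 1 - (j + 1) = q := ⟨_, rfl⟩
      have h2 := hno j (by omega) (by omega)
      rw [← h1] at h2
      rw [show cut τ x 1 - j = p + 1 by omega] at h1 h2
      rw [show cut τ y 1 - j = q + 1 by omega] at h1
      rw [Function.iterate_succ_apply', Function.iterate_succ_apply'] at h1
      rw [Function.iterate_succ_apply'] at h2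
      rw [hp, hq]
      exact hw.eq_of_ne _ (iterate_mem_generatedSubshift hxτ p) _
        (iterate_mem_generatedSubshift hyτ q) h1 fun h => h2 h h
  have h1 := (hback _ le_rfl).symm
  rw [Nat.sub_self, Function.iterate_zero, id] at h1
  -- Now τ(x) starts inside the block τ(y₀), before its end. By recognizability this position is a
  -- cut, so it is 0 and τ(x) = τ(y).
  obtain ⟨q, hq⟩ := exists_eq_cut hne hτ.fixed hτ.recognizable hy hx h1
  have hpos : 0 < cut τ x 1 := le_cut hne x 1
  have hq0 : q < 1 := (strictMono_cut hne y).lt_iff_lt.1 (by omega)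
  obtain rfl : q = 0 := by omega
  rw [hq, cut_zero, Function.iterate_zero, id] at h1
  exact hxy (injOn_substSeq hne hτ.injective hτ.fixed hτ.recognizable hx hy h1.symm)

/-- The branch point is `s τ(w)`, where `s` is a suffix of `τ(a)` for all letters `a` that can
precede `w`. -/
theorem exists_suffix_length (hw : IsUniqueBranch u w) : ∃ j, seqShift^[j] w = substSeq τ w ∧
    ∀ x ∈ generatedSubshift u, seqShift x = w → j ≤ (τ (x 0)).length ∧
      seqShift^[(τ (x 0)).length - j] (substSeq τ x) = w := by
  have hj : ∀ x ∈ generatedSubshift u, seqShift x = w → ∃ j ≤ (τ (x 0)).length,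
      seqShift^[(τ (x 0)).length - j] (substSeq τ x) = w ∧ seqShift^[j] w = substSeq τ w := by
    intro x hx hxw
    obtain ⟨y, hy, hyw, hxy⟩ : ∃ y ∈ generatedSubshift u, seqShift y = w ∧ x ≠ y := by
      obtain ⟨y, hy, z, hz, hyw, hzw, hyz⟩ := hw.exists_ne
      by_cases h : x = y
      · exact ⟨z, hz, hzw, h ▸ hyz⟩
      · exact ⟨y, hy, hyw, h⟩
    obtain ⟨j, hj, h⟩ := hτ.exists_common_suffix hw hx hy hxw hyw hxy
    refine ⟨j, hj, h, ?_⟩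
    have h2 := iterate_cut_substSeq hτ.ne_nil x 1
    rw [cut_one, Function.iterate_one, hxw] at h2
    rw [← h, ← Function.iterate_add_apply, Nat.add_sub_cancel' hj, h2, h]
  obtain ⟨x, hx, -, -, hxw, -, -⟩ := hw.exists_ne
  obtain ⟨j, -, -, hjw⟩ := hj x hx hxw
  refine ⟨j, hjw, fun y hy hyw => ?_⟩
  obtain ⟨i, hi, h, hiw⟩ := hj y hy hyw
  -- The length does not depend on the preimage: σⁱ(w) = τ(w) = σʲ(w) forces i = j by aperiodicity.
  obtain rfl := iterate_seqShift_inj hτ.aperiodic hw.mem (hiw.trans hjw.symm)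
  exact ⟨hi, h⟩

end IsAdmissible

/-- For each letter a, either `a w` belongs to the subshift or one of its finite prefixes is
forbidden there. The maximum over the finitely many letters serves as window. -/
theorem exists_window [Finite A] (u w : ℕ → A) : ∃ m, ∀ x ∈ generatedSubshift u,
    AgreeUpTo m (seqShift x) w → ∃ y ∈ generatedSubshift u, seqShift y = w ∧ y 0 = x 0 := by
  let pre : A → ℕ → A := fun a n => Nat.casesOn n a w
  have h : ∀ a, ∃ m, pre a ∈ generatedSubshift u ∨
      ∀ x ∈ generatedSubshift u, ¬ AgreeUpTo m x (pre a) := by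
    intro a
    by_cases ha : pre a ∈ generatedSubshift u
    · exact ⟨0, Or.inl ha⟩
    · rw [mem_generatedSubshift_iff] at ha
      push Not at ha
      obtain ⟨m, hm⟩ := ha
      refine ⟨m, Or.inr fun x hx hxa => ?_⟩
      obtain ⟨n, hn⟩ := mem_generatedSubshift_iff.1 hx m
      exact hm n (hn.trans hxa)
  choose f hf using h
  obtain ⟨M, hM⟩ := Finite.exists_le f
  refine ⟨M, fun x hx hxw => ?_⟩
  rcases hf (x 0) with h | h
  · exact ⟨_, h, rfl, rfl⟩
  · refine absurd (fun i hi => ?_) (h x hx)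
    rcases i with _ | i
    · rfl
    · exact hxw i (by have := hM (x 0); omega)

/-- The data of a self-similar cylinder: the branch point is `w = s τ(w)`, where `s` has length
`j`, and whenever `a x` is a point with `x` in the cylinder of length `m` of `w`, the word
`s` is a suffix of `τ(a)`. -/
structure IsSelfSimilar (τ : A → List A) (u w : ℕ → A) (j m : ℕ) : Prop where
  adm : IsAdmissible τ u
  branch : IsUniqueBranch u w
  shift_eq : seqShift^[j] w = substSeq τ w
  suffix : ∀ x ∈ generatedSubshift u, AgreeUpTo m (seqShift x) w → j ≤ (τ (x 0)).length ∧
    seqShift^[(τ (x 0)).length - j] (substSeq τ x) = prependSubst τ w j (seqShift x)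
  exists_long : ∃ p < m, 2 ≤ (τ (w p)).length

theorem IsAdmissible.exists_isSelfSimilar [Finite A] (hτ : IsAdmissible τ u)
    (hw : IsUniqueBranch u w) : ∃ j m, IsSelfSimilar τ u w j m := by
  obtain ⟨j, hj, hsuff⟩ := hτ.exists_suffix_length hw
  obtain ⟨m, hm⟩ := exists_window u w
  obtain ⟨p, hp⟩ := hτ.exists_agreeUpTo hw.mem (self_mem_generatedSubshift u) 1
  have hp0 : w p = u 0 := by simpa [iterate_seqShift_apply] using hp 0 zero_lt_one
  -- The cylinder must be long enough for the window and must also contain an occurrence p of u₀ in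
  -- w, whose image has at least two letters.
  refine ⟨j, max m (p + 1), hτ, hw, hj, fun x hx hxw => ?_, p, by omega, hp0 ▸ hτ.two_le⟩
  obtain ⟨y, hy, hyw, hyx⟩ := hm x hx (hxw.mono (le_max_left _ _))
  obtain ⟨h1, h2⟩ := hsuff y hy hyw
  rw [hyx] at h1 h2
  refine ⟨h1, eq_prependSubst ?_ ?_⟩
  · have h3 : AgreeUpTo 1 x y := fun i hi => by
      obtain rfl : i = 0 := by omega
      exact hyx.symm
    have h4 := h3.map hτ.ne_nil
    rw [cut_one] at h4
    have h5 := (h4.mono (n := (τ (x 0)).length - j + j) (by omega)).shift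
    rwa [h2] at h5
  · rw [← Function.iterate_add_apply, Nat.add_sub_cancel' h1, ← cut_one,
      iterate_cut_substSeq hτ.ne_nil, Function.iterate_one]

end Branch

/-! ### Induced systems on the self-similar cylinder -/

/-- The points of the subshift of `u` that have the same prefix of length `m` as `w`. -/
def PrefixCylinder {A : Type*} [TopologicalSpace A] (u w : ℕ → A) (m : ℕ) : Type _ :=
  {x : ℕ → A // x ∈ generatedSubshift u ∧ AgreeUpTo m x w}

namespace PrefixCylinder

variable {A : Type*} [TopologicalSpace A] {u w : ℕ → A} {m : ℕ}

instance : TopologicalSpace (PrefixCylinder u w m) := instTopologicalSpaceSubtype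

instance [DiscreteTopology A] : T2Space (PrefixCylinder u w m) :=
  inferInstanceAs (T2Space {x : ℕ → A // x ∈ generatedSubshift u ∧ AgreeUpTo m x w})

instance [DiscreteTopology A] [Finite A] : CompactSpace (PrefixCylinder u w m) :=
  isCompact_iff_compactSpace.1
    (isClosed_closure.inter (isClopen_agreeUpTo m w).isClosed).isCompact

/-- The inclusion of the cylinder into the subshift. -/
def incl (x : PrefixCylinder u w m) : generatedSubshift u := ⟨x.1, x.2.1⟩

theorem continuous_val : Continuous fun x : PrefixCylinder u w m => x.1 := continuous_subtype_val

theorem continuous_incl : Continuous (incl : PrefixCylinder u w m → _) :=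
  continuous_val.subtype_mk _

theorem injective_incl : Function.Injective (incl : PrefixCylinder u w m → _) :=
  fun _ _ h => Subtype.ext (Subtype.mk.inj h)

theorem mem_range_incl {x : generatedSubshift u} :
    x ∈ Set.range (incl : PrefixCylinder u w m → _) ↔ AgreeUpTo m x.1 w := by
  constructor
  · rintro ⟨y, rfl⟩
    exact y.2.2
  · exact fun h => ⟨⟨x.1, x.2, h⟩, rfl⟩

theorem eventually_agreeUpTo [DiscreteTopology A] (x : PrefixCylinder u w m) (q : ℕ) :
    ∀ᶠ y in nhds x, AgreeUpTo q y.1 x.1 :=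
  continuous_val.continuousAt.eventually_mem
    ((isClopen_agreeUpTo q x.1).isOpen.mem_nhds (AgreeUpTo.refl q x.1))

end PrefixCylinder

theorem coe_iterate_subshiftMap {A : Type*} [TopologicalSpace A] {u : ℕ → A} (n : ℕ)
    (x : generatedSubshift u) : ((subshiftMap u)^[n] x).1 = seqShift^[n] x.1 := by
  induction n generalizing x with
  | zero => rfl
  | succ n ih => rw [Function.iterate_succ_apply, ih]; rfl

namespace IsSelfSimilar

open PrefixCylinder

variable {A : Type*} [TopologicalSpace A] [DiscreteTopology A] {τ : A → List A} {u w : ℕ → A}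
  {j m : ℕ} (hs : IsSelfSimilar τ u w j m)

theorem agreeUpTo_prependSubst_of (hτ : ∀ a, τ a ≠ []) {q : ℕ} {x y : ℕ → A}
    (h : AgreeUpTo q x y) :
    AgreeUpTo (j + cut τ x q) (prependSubst τ w j x) (prependSubst τ w j y) := by
  refine ((agreeUpTo_prependSubst τ w j x).trans
    (agreeUpTo_prependSubst τ w j y).symm).of_shift ?_
  rw [iterate_prependSubst, iterate_prependSubst]
  exact h.map hτ

theorem continuous_prependSubst (hτ : ∀ a, τ a ≠ []) : Continuous (prependSubst τ w j) := by
  refine continuous_pi fun n => ?_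
  simp only [prependSubst]
  split_ifs
  · exact continuous_const
  · exact (continuous_apply (n - j)).comp (continuous_substSeq hτ)

include hs

theorem prependSubst_self : prependSubst τ w j w = w :=
  (eq_prependSubst (AgreeUpTo.refl j w) hs.shift_eq).symm

/-- The long letter inside the cylinder word makes agreement with the fixed point w grow at each
step, so the iterates of the self-similarity converge uniformly to w. -/
theorem agreeUpTo_succ {q : ℕ} (hq : m ≤ q) {x : ℕ → A} (h : AgreeUpTo q x w) :
    AgreeUpTo (q + 1) (prependSubst τ w j x) w := by
  obtain ⟨p, hp, hlong⟩ := hs.exists_long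
  have h1 := agreeUpTo_prependSubst_of (w := w) (j := j) hs.adm.ne_nil h
  rw [hs.prependSubst_self] at h1
  refine h1.mono ?_
  rw [← h p (by omega)] at hlong
  have := lt_cut hs.adm.ne_nil x (m := q) hlong (by omega)
  omega

/-- If y is a preimage of x, then s τ(x) is a tail of τ(y). -/
theorem prependSubst_mem [Finite A] {x : ℕ → A} (hx : x ∈ generatedSubshift u)
    (h : AgreeUpTo m x w) : prependSubst τ w j x ∈ generatedSubshift u := by
  obtain ⟨y, hy, rfl⟩ := hs.adm.exists_preimage hx
  rw [← (hs.suffix y hy h).2]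
  exact iterate_mem_generatedSubshift (substSeq_mem hs.adm.ne_nil hs.adm.fixed hy) _

/-- The self-similarity `x ↦ s τ(x)` of the cylinder. -/
def contraction [Finite A] (x : PrefixCylinder u w m) : PrefixCylinder u w m :=
  ⟨prependSubst τ w j x.1, hs.prependSubst_mem x.2.1 x.2.2,
    (hs.agreeUpTo_succ le_rfl x.2.2).mono (Nat.le_succ m)⟩

/-- The branch point, as a point of the cylinder. -/
def center : PrefixCylinder u w m := ⟨w, hs.branch.mem, AgreeUpTo.refl m w⟩

variable [Finite A]

theorem contraction_center : hs.contraction hs.center = hs.center :=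
  Subtype.ext hs.prependSubst_self

theorem agreeUpTo_iterate_contraction (n : ℕ) (x : PrefixCylinder u w m) :
    AgreeUpTo (m + n) (hs.contraction^[n] x).1 w := by
  induction n with
  | zero => exact x.2.2
  | succ n ih =>
    rw [Function.iterate_succ_apply']
    exact hs.agreeUpTo_succ (Nat.le_add_right m n) ih

theorem eq_center_of_fixed {x : PrefixCylinder u w m} (h : hs.contraction x = x) :
    x = hs.center := by
  refine Subtype.ext (eq_of_forall_agreeUpTo fun n => ?_)
  have := hs.agreeUpTo_iterate_contraction n x
  rw [Function.iterate_fixed h] at this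
  exact this.mono (by omega)

theorem continuous_contraction : Continuous hs.contraction :=
  ((continuous_prependSubst hs.adm.ne_nil).comp continuous_val).subtype_mk _

theorem substSeq_eq_of_contraction_eq {x y : ℕ → A}
    (h : prependSubst τ w j x = prependSubst τ w j y) : substSeq τ x = substSeq τ y := by
  rw [← iterate_prependSubst τ w j x, h, iterate_prependSubst]

theorem injOn_subst : Set.InjOn (substSeq τ) (generatedSubshift u) :=
  injOn_substSeq hs.adm.ne_nil hs.adm.injective hs.adm.fixed hs.adm.recognizable

theorem injective_contraction : Function.Injective hs.contraction := fun x y h =>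
  Subtype.ext (hs.injOn_subst x.2.1 y.2.1
    (hs.substSeq_eq_of_contraction_eq (congrArg Subtype.val h)))

/-- If y is close to s τ(x), then y starts with s, and recognizability makes the rest τ(z) for some
z in the subshift. That z lies in the cylinder, because the images of points outside it form a
closed set which, by injectivity, misses τ(x). -/
theorem isOpen_range_contraction : IsOpen (Set.range hs.contraction) := by
  have hcont := continuous_substSeq hs.adm.ne_nil
  obtain ⟨L, hL⟩ := exists_mem_of_agreeUpTo_substSeq hs.adm.ne_nil hs.adm.fixed
    hs.adm.recognizable
  let F := substSeq τ '' (generatedSubshift u ∩ {x | AgreeUpTo m x w}ᶜ)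
  have hF : IsClosed F := ((isClosed_closure.inter
    (isClopen_agreeUpTo m w).compl.isClosed).isCompact.image hcont).isClosed
  rw [isOpen_iff_mem_nhds]
  rintro _ ⟨x, rfl⟩
  have h1 := eventually_agreeUpTo (hs.contraction x) (j + L)
  have h2 : ∀ᶠ y : PrefixCylinder u w m in nhds (hs.contraction x), seqShift^[j] y.1 ∈ Fᶜ := by
    refine ((continuous_seqShift.iterate j).comp continuous_val).continuousAt.eventually_mem
      (hF.isOpen_compl.mem_nhds ?_)
    rintro ⟨y, ⟨hy, hyw⟩, h⟩
    rw [Function.comp_apply, contraction, iterate_prependSubst] at h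
    exact hyw (hs.injOn_subst hy x.2.1 h ▸ x.2.2)
  filter_upwards [h1, h2] with y h1 h2
  have h3 := h1.shift
  rw [contraction, iterate_prependSubst] at h3
  obtain ⟨z, hz, hzy⟩ := hL x.1 _ x.2.1 (iterate_mem_generatedSubshift y.2.1 j) h3
  have hzw : AgreeUpTo m z w := by
    by_contra hzw
    exact h2 ⟨z, ⟨hz, hzw⟩, hzy⟩
  refine ⟨⟨z, hz, hzw⟩, Subtype.ext (eq_prependSubst ?_ hzy.symm).symm⟩
  exact (h1.mono (Nat.le_add_right j L)).trans (agreeUpTo_prependSubst τ w j x.1)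

theorem injective_off {y y' : generatedSubshift u} (h : subshiftMap u y = subshiftMap u y')
    (hne : subshiftMap u y ≠ incl hs.center) : y = y' :=
  Subtype.ext (hs.branch.eq_of_ne _ y.2 _ y'.2 (congrArg Subtype.val h)
    fun h' => hne (Subtype.ext h'))

theorem surjective_subshiftMap : Function.Surjective (subshiftMap u) := fun x => by
  obtain ⟨y, hy, h⟩ := hs.adm.exists_preimage x.2
  exact ⟨⟨y, hy⟩, Subtype.ext h⟩

theorem exists_tower_incl :
    Nonempty (Tower (subshiftMap u) (incl : PrefixCylinder u w m → _)) := by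
  have := isCompact_iff_compactSpace.1 (isCompact_generatedSubshift u)
  refine Tower.exists_tower (continuous_seqShift.restrict (mapsTo_seqShift u)) continuous_incl
    injective_incl ?_ hs.surjective_subshiftMap ?_ ?_
  · have : Set.range (incl : PrefixCylinder u w m → _) =
        Subtype.val ⁻¹' {x : ℕ → A | AgreeUpTo m x w} := by
      ext x
      exact mem_range_incl
    rw [this]
    exact (isClopen_agreeUpTo m w).isOpen.preimage continuous_subtype_val
  · exact fun y y' h hne => hs.injective_off h fun h' => hne ⟨_, h'.symm⟩
  · intro y
    obtain ⟨n, hn⟩ := hs.adm.exists_agreeUpTo y.2 hs.branch.mem m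
    exact ⟨n, mem_range_incl.2 (by rwa [coe_iterate_subshiftMap])⟩

/-! ### Return times to the cylinder and to its image under the contraction -/

variable (t : Tower (subshiftMap u) (incl : PrefixCylinder u w m → _))

omit hs in
theorem coe_R (z : PrefixCylinder u w m) : (t.R z).1 = seqShift^[t.ret z] z.1 := by
  have := congrArg Subtype.val (t.iterate_ret z)
  rw [coe_iterate_subshiftMap] at this
  exact this.symm

omit hs in
theorem coe_iterate_R (n : ℕ) (z : PrefixCylinder u w m) :
    (t.R^[n] z).1 = seqShift^[totalTime t.ret t.R n z] z.1 := by
  have := congrArg Subtype.val (t.iterate_totalTime n z)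
  rw [coe_iterate_subshiftMap] at this
  exact this.symm

omit hs in
theorem ret_le_of_agreeUpTo {z : PrefixCylinder u w m} {n : ℕ} (hn : 0 < n)
    (h : AgreeUpTo m (seqShift^[n] z.1) w) : t.ret z ≤ n :=
  t.ret_le hn (mem_range_incl.2 (by rwa [coe_iterate_subshiftMap]))

omit hs in
theorem exists_iterate_R_eq {z z' : PrefixCylinder u w m} {n : ℕ} (h : seqShift^[n] z.1 = z'.1) :
    ∃ q, n = totalTime t.ret t.R q z ∧ t.R^[q] z = z' := by
  obtain ⟨q, rfl⟩ := t.exists_eq_totalTime n z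
    ⟨z', Subtype.ext (by rw [coe_iterate_subshiftMap]; exact h.symm)⟩
  exact ⟨q, rfl, Subtype.ext ((coe_iterate_R t q z).trans h)⟩

/-- The fixed point w of the contraction lies in its range, so the return map is injective off that
range. The range is a neighbourhood of w in the cylinder, so minimality makes every orbit enter it.
-/
theorem exists_tower_contraction : Nonempty (Tower t.R hs.contraction) := by
  refine Tower.exists_tower t.continuous_R hs.continuous_contraction hs.injective_contraction
    hs.isOpen_range_contraction (t.surjective_R hs.surjective_subshiftMap) ?_ ?_
  · intro y y' h hne
    exact t.injective_R_off injective_incl hs.center (fun _ _ => hs.injective_off) y y' h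
      fun h' => hne ⟨hs.center, hs.contraction_center.trans h'.symm⟩
  · intro y
    obtain ⟨O, hO, hOr⟩ := isOpen_induced_iff.1 hs.isOpen_range_contraction
    have hw : w ∈ O := by
      have : hs.center ∈ Set.range hs.contraction := ⟨_, hs.contraction_center⟩
      rwa [← hOr] at this
    obtain ⟨M, hM⟩ := exists_agreeUpTo_subset (hO.mem_nhds hw)
    obtain ⟨n, hn⟩ := hs.adm.exists_agreeUpTo y.2.1 hs.branch.mem (max m M)
    obtain ⟨q, -, hq⟩ := exists_iterate_R_eq t (z := y) (n := n)
      (z' := ⟨_, iterate_mem_generatedSubshift y.2.1 n, hn.mono (le_max_left _ _)⟩) rfl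
    refine ⟨q, ?_⟩
    rw [hq, ← hOr]
    exact hM _ (hn.mono (le_max_right _ _))

/-- The letter before the return point R(z) has an image ending in s. Deleting the image of the
return word from τ(z) leaves τ(R z); starting from s τ(z) instead, the deletion stops j letters
earlier and leaves s τ(R z). -/
theorem iterate_contraction_eq (z : PrefixCylinder u w m) :
    seqShift^[cut τ z.1 (t.ret z)] (hs.contraction z).1 = (hs.contraction (t.R z)).1 := by
  obtain ⟨r, hr⟩ := Nat.exists_eq_succ_of_ne_zero (t.ret_pos z).ne'
  have hR := coe_R t z
  rw [hr, Function.iterate_succ_apply'] at hR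
  obtain ⟨h1, h2⟩ := hs.suffix (seqShift^[r] z.1) (iterate_mem_generatedSubshift z.2.1 r)
    (hR ▸ (t.R z).2.2)
  rw [← hR, ← iterate_cut_substSeq hs.adm.ne_nil, ← iterate_prependSubst τ w j z.1,
    ← Function.iterate_add_apply, ← Function.iterate_add_apply] at h2
  change seqShift^[_] (prependSubst τ w j z.1) = prependSubst τ w j (t.R z).1
  rw [← h2]
  congr 2
  rw [hr, Nat.succ_eq_add_one, cut_succ]
  rw [iterate_seqShift_apply, add_zero] at *
  omega

/-- After removal of s, recognizability makes i the length of the image of some prefix z₀ ⋯ z_{q-1}.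
Injectivity of τ identifies σ^q(z) with z', so q is a visit of z to the cylinder. -/
theorem cut_le_of_iterate_eq {z z' : PrefixCylinder u w m} {i : ℕ} (hi : 0 < i)
    (h : seqShift^[i] (hs.contraction z).1 = (hs.contraction z').1) :
    cut τ z.1 (t.ret z) ≤ i := by
  have hne := hs.adm.ne_nil
  have h1 := congrArg seqShift^[j] h
  rw [← Function.iterate_add_apply, add_comm, Function.iterate_add_apply, contraction, contraction,
    iterate_prependSubst, iterate_prependSubst] at h1
  obtain ⟨q, rfl⟩ := exists_eq_cut hne hs.adm.fixed hs.adm.recognizable z.2.1 z'.2.1 h1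
  rw [iterate_cut_substSeq hne] at h1
  have h2 := hs.injOn_subst (iterate_mem_generatedSubshift z.2.1 q) z'.2.1 h1
  have hq : 0 < q := by
    by_contra h0
    obtain rfl : q = 0 := by omega
    exact lt_irrefl _ hi
  exact (strictMono_cut hne _).monotone (ret_le_of_agreeUpTo t hq (h2 ▸ z'.2.2))

variable (t' : Tower t.R hs.contraction)

/-- The self-similarity: the contraction conjugates the return map to the map it induces on the
smaller set. `iterate_contraction_eq` exhibits a return, and `cut_le_of_iterate_eq` excludes an
earlier one. -/
theorem tower_return (z : PrefixCylinder u w m) :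
    totalTime t.ret t.R (t'.ret z) (hs.contraction z) = cut τ z.1 (t.ret z) ∧
      t'.R z = t.R z := by
  have hmono := t.strictMono_totalTime (hs.contraction z)
  have h1 := coe_iterate_R t (t'.ret z) (hs.contraction z)
  rw [t'.iterate_ret] at h1
  have hpos : 0 < totalTime t.ret t.R (t'.ret z) (hs.contraction z) := hmono (t'.ret_pos z)
  have h2 := hs.cut_le_of_iterate_eq t hpos h1.symm
  have h3 := hs.iterate_contraction_eq t z
  obtain ⟨q, hq, hq'⟩ := exists_iterate_R_eq t h3
  have hcut : 0 < cut τ z.1 (t.ret z) :=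
    lt_of_lt_of_le (t.ret_pos z) (le_cut hs.adm.ne_nil _ _)
  have hq0 : 0 < q := by
    by_contra h0
    obtain rfl : q = 0 := by omega
    rw [hq] at hcut
    exact lt_irrefl _ hcut
  have h4 : totalTime t.ret t.R (t'.ret z) (hs.contraction z) ≤ _ :=
    hmono.monotone (t'.ret_le hq0 ⟨t.R z, hq'.symm⟩)
  have h5 := le_antisymm (h4.trans hq.symm.le) h2
  refine ⟨h5, hs.injective_contraction (Subtype.ext ?_)⟩
  rw [h1, h5, h3]

/-! ### Labels -/

-- A return by time Q is detected by the first Q + m letters, so points sharing these have the same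
-- return word.
omit hs in
theorem ret_eq_of_agreeUpTo {z z' : PrefixCylinder u w m} {Q : ℕ} (hQ : 0 < Q)
    (h : AgreeUpTo (Q + m) z.1 z'.1) (hz : AgreeUpTo m (seqShift^[Q] z.1) w) :
    t.ret z ≤ Q ∧ t.ret z = t.ret z' ∧ AgreeUpTo (t.ret z) z.1 z'.1 := by
  have hle := ret_le_of_agreeUpTo t hQ hz
  have h1 : t.ret z' ≤ t.ret z := by
    refine ret_le_of_agreeUpTo t (t.ret_pos z) ?_
    refine ((h.mono (n := t.ret z + m) (by omega)).symm.shift).trans ?_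
    rw [← coe_R]
    exact (t.R z).2.2
  have h2 : t.ret z ≤ t.ret z' := by
    refine ret_le_of_agreeUpTo t (t.ret_pos z') ?_
    refine ((h.mono (n := t.ret z' + m) (by omega)).shift).trans ?_
    rw [← coe_R]
    exact (t.R z').2.2
  exact ⟨hle, le_antisymm h2 h1, h.mono (by omega)⟩

/-- The return word of a point of the cylinder. -/
def returnWord (z : PrefixCylinder u w m) : List A := seqPrefix z.1 (t.ret z)

omit hs in
theorem returnWord_eq_iff {z z' : PrefixCylinder u w m} :
    returnWord t z = returnWord t z' ↔ t.ret z = t.ret z' ∧ AgreeUpTo (t.ret z) z.1 z'.1 := by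
  constructor
  · intro h
    have h1 : t.ret z = t.ret z' := by
      simpa only [returnWord, length_seqPrefix] using congrArg List.length h
    rw [returnWord, returnWord, ← h1] at h
    exact ⟨h1, agreeUpTo_of_seqPrefix_eq h⟩
  · rintro ⟨h1, h2⟩
    rw [returnWord, returnWord, ← h1]
    exact h2.seqPrefix_eq

omit hs in
theorem isLocallyConstant_returnWord : IsLocallyConstant (returnWord t) := by
  refine (IsLocallyConstant.iff_eventually_eq _).2 fun z => ?_
  have h1 : ∀ᶠ y in nhds z, t.ret y = t.ret z :=
    (IsLocallyConstant.iff_eventually_eq _).1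
      ((IsLocallyConstant.iff_continuous _).2 t.continuous_ret) z
  filter_upwards [h1, eventually_agreeUpTo z (t.ret z)] with y h1 h2
  exact (returnWord_eq_iff t).2 ⟨h1, h1 ▸ h2⟩

/-- The return word of `z` determines the return words met by the image of `z`. -/
theorem returnWord_iterate_eq {z z' : PrefixCylinder u w m}
    (h : returnWord t z = returnWord t z') : t'.ret z = t'.ret z' ∧ ∀ i < t'.ret z,
      returnWord t (t.R^[i] (hs.contraction z)) = returnWord t (t.R^[i] (hs.contraction z')) := by
  obtain ⟨hret, hagree⟩ := (returnWord_eq_iff t).1 h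
  have hne := hs.adm.ne_nil
  obtain ⟨hP, -⟩ := hs.tower_return t t' z
  obtain ⟨hP', -⟩ := hs.tower_return t t' z'
  have hcut : cut τ z'.1 (t.ret z') = cut τ z.1 (t.ret z) := by
    rw [← hret]
    exact (hagree.cut_eq le_rfl).symm
  rw [hcut] at hP'
  have h3 := hs.iterate_contraction_eq t z
  have h3' := hs.iterate_contraction_eq t z'
  rw [hcut] at h3'
  have hprefix : AgreeUpTo (cut τ z.1 (t.ret z)) (hs.contraction z).1 (hs.contraction z').1 :=
    (agreeUpTo_prependSubst_of hne hagree).mono (Nat.le_add_left _ _)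
  generalize cut τ z.1 (t.ret z) = P at *
  -- At time P both orbits are back in the cylinder, which yields m more common letters, enough to
  -- detect all returns up to P.
  have hlong : AgreeUpTo (P + m) (hs.contraction z).1 (hs.contraction z').1 := by
    refine hprefix.of_shift ?_
    rw [h3, h3']
    exact (hs.contraction _).2.2.trans (hs.contraction _).2.2.symm
  have hmono := t.strictMono_totalTime (hs.contraction z)
  have hstep : ∀ i < t'.ret z, totalTime t.ret t.R i (hs.contraction z') =
      totalTime t.ret t.R i (hs.contraction z) →
      returnWord t (t.R^[i] (hs.contraction z)) = returnWord t (t.R^[i] (hs.contraction z')) := by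
    intro i hi htime
    have hK : totalTime t.ret t.R i (hs.contraction z) < P := hP ▸ hmono hi
    have hy := coe_iterate_R t i (hs.contraction z)
    have hy' := coe_iterate_R t i (hs.contraction z')
    rw [htime] at hy'
    generalize totalTime t.ret t.R i (hs.contraction z) = K at hK hy hy'
    refine (returnWord_eq_iff t).2 (ret_eq_of_agreeUpTo t (Q := P - K) (by omega) ?_ ?_).2
    · rw [hy, hy']
      exact (hlong.mono (show K + (P - K + m) ≤ P + m by omega)).shift
    · rw [hy, ← Function.iterate_add_apply, Nat.sub_add_cancel hK.le, h3]
      exact (hs.contraction _).2.2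
  have htime : ∀ i ≤ t'.ret z, totalTime t.ret t.R i (hs.contraction z') =
      totalTime t.ret t.R i (hs.contraction z) := by
    intro i
    induction i with
    | zero => exact fun _ => rfl
    | succ i ih =>
      intro hi
      have h1 := ih (by omega)
      rw [t.totalTime_succ, t.totalTime_succ, h1,
        ((returnWord_eq_iff t).1 (hstep i (by omega) h1)).1]
  refine ⟨?_, fun i hi => hstep i hi (htime i hi.le)⟩
  refine (t.strictMono_totalTime (hs.contraction z')).injective ?_
  rw [htime _ le_rfl, hP, hP']

end IsSelfSimilar

/-! ### The Bratteli diagram of the subshift -/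

namespace IsSelfSimilar

open PrefixCylinder

variable {A : Type*} [TopologicalSpace A] [DiscreteTopology A] [Finite A] {τ : A → List A}
  {u w : ℕ → A} {j m : ℕ} (hs : IsSelfSimilar τ u w j m)
  (t : Tower (subshiftMap u) (incl : PrefixCylinder u w m → _)) (t' : Tower t.R hs.contraction)

/-- The coding of the subshift by return words to the cylinder, for a numbering `c` of the return
words. -/
noncomputable def adicData {V : Type} (c : PrefixCylinder u w m → V)
    (hc : Function.Surjective c) (hcw : ∀ z z', c z = c z' ↔ returnWord t z = returnWord t z') :
    AdicData (subshiftMap u) t.R V :=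
  -- Heights are read off a chosen representative of each label; equal return words make the choice
  -- immaterial.
  have hret : ∀ z, t.ret (Function.surjInv hc (c z)) = t.ret z := fun z =>
    ((returnWord_eq_iff t).1 ((hcw _ _).1 (Function.surjInv_eq hc _))).1
  have hret' : ∀ z, t'.ret (Function.surjInv hc (c z)) = t'.ret z := fun z =>
    (hs.returnWord_iterate_eq t t' ((hcw _ _).1 (Function.surjInv_eq hc _))).1
  { c := c
    h := fun v => t.ret (Function.surjInv hc v)
    len := fun v => t'.ret (Function.surjInv hc v)
    src := fun v i => c (t.R^[i] (hs.contraction (Function.surjInv hc v)))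
    base := t.base
    ht := t.ht
    tail := t'.base
    idx := t'.ht
    c_surj := hc
    h_pos := fun _ => t.ret_pos _
    len_pos := fun _ => t'.ret_pos _
    ht_lt := fun x => by rw [hret]; exact t.ht_lt x
    idx_lt := fun z => by rw [hret']; exact t'.ht_lt z
    exists_base := fun z k hk => by
      rw [hret] at hk
      exact ⟨_, t.base_iterate z k hk, t.ht_iterate z k hk⟩
    exists_tail := fun z k hk => by
      rw [hret'] at hk
      exact ⟨_, t'.base_iterate z k hk, t'.ht_iterate z k hk⟩
    base_succ := fun x hx => by rw [hret] at hx; exact t.base_succ x hx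
    base_top := fun x hx => by rw [hret] at hx; exact t.base_top x hx
    tail_succ := fun z hz => by rw [hret'] at hz; exact t'.base_succ z hz
    tail_top := fun z hz => by
      rw [hret'] at hz
      -- The second tower has the same return map R as the first, so the same pattern repeats at
      -- every level.
      rw [← (hs.tower_return t t' (t'.base z)).2]
      exact t'.base_top z hz
    c_eq := fun z => by
      have h := (hs.returnWord_iterate_eq t t' ((hcw _ _).1
        (Function.surjInv_eq hc (c (t'.base z))).symm)).2 (t'.ht z) (t'.ht_lt z)
      rw [t'.iterate_ht] at h
      exact (hcw _ _).2 h
    isLocallyConstant_c := (IsLocallyConstant.iff_eventually_eq _).2 fun z =>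
      ((IsLocallyConstant.iff_eventually_eq _).1 (isLocallyConstant_returnWord t) z).mono
        fun y hy => (hcw y z).2 hy
    continuous_base := t.continuous_base
    continuous_tail := t'.continuous_base
    continuous_ht := t.continuous_ht
    continuous_idx := t'.continuous_ht }

/-! ### The orbit of the branch point under the return map -/

theorem tail_center : t'.base hs.center = hs.center := by
  have := t'.base_iterate_zero hs.center
  rwa [hs.contraction_center] at this

/-- Were the return immediate, R(w) would be fixed by the contraction, hence equal to w, and w would
be periodic. -/
theorem one_lt_ret_center : 1 < t'.ret hs.center := by
  by_contra hlt
  have h1 : t'.ret hs.center = 1 := by have := t'.ret_pos hs.center; omega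
  have h2 := t'.iterate_ret hs.center
  rw [h1, hs.contraction_center, (hs.tower_return t t' hs.center).2] at h2
  have h3 := hs.eq_center_of_fixed h2.symm
  have h4 := coe_R t hs.center
  rw [h3] at h4
  have := iterate_seqShift_inj hs.adm.aperiodic hs.branch.mem (i := 0) h4
  have := t.ret_pos hs.center
  omega

/-- Passing to the base point divides time: the tower over w has at least two floors, so time 1
still lies over time 0, and afterwards the time of the base point grows by at most one per step. -/
theorem tail_iterate_center (q : ℕ) :
    ∃ i ≤ q, t'.base (t.R^[q + 1] hs.center) = t.R^[i] hs.center := by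
  induction q with
  | zero =>
    have := t'.base_iterate hs.center 1 (hs.one_lt_ret_center t t')
    rw [hs.contraction_center] at this
    exact ⟨0, le_rfl, this⟩
  | succ q ih =>
    obtain ⟨i, hi, h⟩ := ih
    rw [Function.iterate_succ_apply']
    rcases Nat.lt_or_ge (t'.ht (t.R^[q + 1] hs.center) + 1)
      (t'.ret (t'.base (t.R^[q + 1] hs.center))) with hlt | hge
    · exact ⟨i, by omega, (t'.base_succ _ hlt).1.trans h⟩
    · have := t'.ht_lt (t.R^[q + 1] hs.center)
      refine ⟨i + 1, by omega, ?_⟩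
      rw [(t'.base_top _ (by omega)).1, (hs.tower_return t t' _).2, h,
        Function.iterate_succ_apply']

theorem iterate_tail_center (q : ℕ) : ∀ i ≤ q, t'.base^[q] (t.R^[i] hs.center) = hs.center := by
  induction q with
  | zero =>
    intro i hi
    obtain rfl : i = 0 := by omega
    rfl
  | succ q ih =>
    intro i hi
    rcases i with _ | i
    · exact Function.iterate_fixed (hs.tail_center t t') _
    · obtain ⟨k, hk, h⟩ := hs.tail_iterate_center t t' i
      rw [Function.iterate_succ_apply, h]
      exact ih k (by omega)

/-- By minimality the orbit of w meets every return word. As the tails of this orbit end at w, it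
gives paths from every vertex to the label of w. -/
theorem exists_returnWord_eq (z : PrefixCylinder u w m) :
    ∃ q, returnWord t (t.R^[q] hs.center) = returnWord t z := by
  obtain ⟨n, hn⟩ := hs.adm.exists_agreeUpTo hs.branch.mem z.2.1 (t.ret z + m)
  obtain ⟨q, -, hq⟩ := exists_iterate_R_eq t (z := hs.center) (n := n)
    (z' := ⟨_, iterate_mem_generatedSubshift hs.branch.mem n,
      (hn.mono (Nat.le_add_left _ _)).trans z.2.2⟩) rfl
  refine ⟨q, ?_⟩
  rw [hq]
  refine ((returnWord_eq_iff t).2 (ret_eq_of_agreeUpTo t (t.ret_pos z) hn.symm ?_).2).symm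
  rw [← coe_R]
  exact (t.R z).2.2

/-- Each contraction adds a letter of agreement with w, and the return time of w many extra letters
suffice to read its return word. Hence the first label becomes constant after that many levels. -/
theorem returnWord_iterate_contraction (z : PrefixCylinder u w m) :
    returnWord t (hs.contraction^[t.ret hs.center] z) = returnWord t hs.center := by
  refine ((returnWord_eq_iff t).2 (ret_eq_of_agreeUpTo t (t.ret_pos hs.center) ?_ ?_).2).symm
  · rw [add_comm]
    exact (hs.agreeUpTo_iterate_contraction _ z).symm
  · have := (t.R hs.center).2.2
    rwa [coe_R] at this

include hs in
theorem exists_bratteli : ∃ (B : StationaryBratteliDiagram) (hB : B.IsSemiProper),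
    TopologicallyConjugate (StationaryBratteliDiagram.vershikMap hB) (subshiftMap u) := by
  classical
  obtain ⟨t⟩ := hs.exists_tower_incl
  obtain ⟨t'⟩ := hs.exists_tower_contraction t
  have hfin : Finite (Set.range (returnWord t)) :=
    (isLocallyConstant_returnWord t).range_finite
  obtain ⟨N, ⟨e⟩⟩ := Finite.exists_equiv_fin (Set.range (returnWord t))
  let c : PrefixCylinder u w m → Fin N := fun z => e ⟨returnWord t z, z, rfl⟩
  have hc : Function.Surjective c := fun v => by
    obtain ⟨⟨_, z, rfl⟩, rfl⟩ := e.surjective v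
    exact ⟨z, rfl⟩
  have hcw : ∀ z z', c z = c z' ↔ returnWord t z = returnWord t z' := fun z z' =>
    e.apply_eq_iff_eq.trans Subtype.ext_iff
  let d := hs.adicData t t' c hc hcw
  have hfirst : ∀ z, d.firstLabel (c z) = c (hs.contraction z) := fun z => by
    have h := (hs.returnWord_iterate_eq t t' ((hcw _ _).1
      (Function.surjInv_eq hc (c z)).symm)).2 0 (t'.ret_pos z)
    exact ((hcw _ _).2 h).symm
  have hfirst' : ∀ n z, d.firstLabel^[n] (c z) = c (hs.contraction^[n] z) := by
    intro n
    induction n with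
    | zero => exact fun _ => rfl
    | succ n ih =>
      intro z
      rw [Function.iterate_succ_apply, Function.iterate_succ_apply, hfirst, ih]
  have : Nonempty (Fin N) := ⟨c hs.center⟩
  have := isCompact_iff_compactSpace.1 (isCompact_generatedSubshift u)
  have hq : ∀ v, ∃ q, c (t.R^[q] hs.center) = v := fun v => by
    obtain ⟨z, rfl⟩ := hc v
    obtain ⟨q, hq⟩ := hs.exists_returnWord_eq t z
    exact ⟨q, (hcw _ _).2 hq⟩
  choose q hq using hq
  obtain ⟨Q, hQ⟩ := Finite.exists_le q
  refine d.exists_conjugate (t.ret hs.center) (c hs.center) ?_ ?_ (t.ret hs.center + Q)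
    (Nat.add_pos_left (t.ret_pos _) _) ?_ ?_
  · rw [hfirst, hs.contraction_center]
  · intro v
    obtain ⟨z, rfl⟩ := hc v
    rw [hfirst']
    exact (hcw _ _).2 (hs.returnWord_iterate_contraction t z)
  · intro v v'
    obtain ⟨z, rfl⟩ := hc v'
    -- From v, Q levels lead to the label of w, since R^{q v}(w) lies Q levels below w. From there
    -- `t.ret hs.center` levels lead to v', by undoing the contractions of z. The lift glues the two
    -- pieces.
    obtain ⟨y, hy, hyv⟩ := d.exists_lift Q (t.R^[q v] hs.center) hs.center
      (hs.contraction^[t.ret hs.center] z) (hs.iterate_tail_center t t' Q _ (hQ v))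
      ((hcw _ _).2 (hs.returnWord_iterate_contraction t z).symm)
    refine ⟨y, hyv.trans (hq v), ?_⟩
    rw [Function.iterate_add_apply, hy]
    exact congrArg c (Function.LeftInverse.iterate (g := t'.base) t'.base_iterate_zero _ z)
  · intro x x' h
    refine Subtype.ext (funext fun n => ?_)
    obtain ⟨h1, h2⟩ := h n
    -- σⁿ(x) stands at some height over its base point, so xₙ is the letter of the base point at
    -- that height, which belongs to its return word.
    have hval : ∀ x : generatedSubshift u, x.1 n =
        (t.base ((subshiftMap u)^[n] x)).1 (t.ht ((subshiftMap u)^[n] x)) := by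
      intro x
      have h3 := congrArg (fun y => y.1 0) (t.iterate_ht ((subshiftMap u)^[n] x))
      simp only [coe_iterate_subshiftMap, iterate_seqShift_apply, add_zero] at h3
      exact h3.symm
    rw [hval x, hval x']
    have h2' : t.ht ((subshiftMap u)^[n] x) = t.ht ((subshiftMap u)^[n] x') := h2
    rw [← h2']
    exact ((returnWord_eq_iff t).1 ((hcw _ _).1 h1)).2 _ (t.ht_lt _)

end IsSelfSimilar

theorem theorem4p3 {A : Type*} [Finite A] [TopologicalSpace A] [DiscreteTopology A]
    (τ : A → List A) (u : ℕ → A)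
    (hprimitive : IsPrimitiveSubst τ)
    (hinjective : PowersInjective τ)
    (hfixed : IsSubstFixedPoint τ u)
    (haperiodic : IsAperiodicSubshift u)
    (hrecognizable : IsRecognizable τ u)
    (hleft : IsLeftProper τ)
    (hquasi : IsQuasiInvertible (subshiftMap u)) :
    ∃ (B : StationaryBratteliDiagram) (hB : B.IsSemiProper),
      TopologicallyConjugate (StationaryBratteliDiagram.vershikMap hB) (subshiftMap u) := by
  have hτ := isAdmissible hprimitive hinjective hfixed haperiodic hrecognizable hleft
  obtain ⟨w, hw⟩ := hτ.exists_isUniqueBranch hquasi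
  obtain ⟨j, m, hs⟩ := hτ.exists_isSelfSimilar hw
  exact hs.exists_bratteli
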